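/- Conventions. Monoids are commutative and cancellative and are written additively. For a domain $D$, let $\mathfrak X(D)$ be the set of its height-one prime ideals. An ideal $P\subseteq S$ of a monoid $S$ (i.e. $S+P\subseteq P$) is prime if $P\neq S$ and $a+b\in P$ implies $a\in P$ or $b\in P$; let $\mathfrak X(S)$ be the set of minimal non-empty prime ideals of $S$, and for $P\in\mathfrak X(S)$ let $S_P=\{a-b\mid a\in S,\ b\in S\setminus P\}$, a subset of the quotient group of $S$. A domain $D$ is called weakly Krull if $D=\bigcap_{P\in\mathfrak X(D)}D_P$ (inside the quotient field of $D$) and every non-zero non-unit of $D$ lies in only finitely many $P\in\mathfrak X(D)$. A monoid $S$ is called weakly Krull if $S=\bigcap_{P\in\mathfrak X(S)}S_P$ (inside the quotient group of $S$) and every non-unit of $S$ lies in only finitely many $P\in\mathfrak X(S)$. Empty intersections are the whole quotient field, respectively the whole quotient group. For a domain $D$ with quotient field $K$ and a torsion-free abelian group $G$, let $D[G]$ be the group algebra and, for an ideal $P$ of $D$, let $P[G]\subseteq D[G]$ be the ideal of all elements with coefficients in $P$; then $D$ is called $G$-UMT if $$\mathfrak X(D[G])=\{P[G]\mid P\in\mathfrak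 X(D)\}\cup\{Q\cap D[G]\mid Q\in\mathfrak X(K[G])\}.$$ **Corollary.** Let $D$ be a domain, let $(G,\leq)$ be a totally ordered abelian group satisfying the ascending chain condition on cyclic subgroups, and let $S=\{g\in G\mid g\geq 0\}$ be the non-negative monoid of $G$. Then the monoid algebra $D[S]$ is weakly Krull if and only if $D$ is weakly Krull and $G$-UMT and $S$ is weakly Krull. -/

import Mathlib

open scoped AddMonoidAlgebra

namespace WeaklyKrull

/-- The set of height-one prime ideals of a commutative ring. -/
def heightOnePrimes (R : Type*) [CommRing R] : Set (PrimeSpectrum R) :=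
  {P | P.asIdeal.height = 1}

/-- A domain `R` is weakly Krull if `R` is the intersection, inside its quotient field, of its
localizations at the height-one primes (the empty intersection being the quotient field), and
every non-zero non-unit lies in only finitely many height-one primes. -/
def IsWeaklyKrullDomain (R : Type*) [CommRing R] [IsDomain R] : Prop :=
  (⨅ P ∈ heightOnePrimes R, Localization.subalgebra.ofField (FractionRing R)
      P.asIdeal.primeCompl P.asIdeal.primeCompl_le_nonZeroDivisors) =
    (⊥ : Subalgebra R (FractionRing R)) ∧
  ∀ a : R, a ≠ 0 → ¬ IsUnit a → {P ∈ heightOnePrimes R | a ∈ P.asIdeal}.Finite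

/-- An ideal `P` of a commutative additive monoid is prime if it is proper and `a + b ∈ P`
implies `a ∈ P` or `b ∈ P`. The empty ideal is prime. -/
def IsPrimeIdeal {S : Type*} [AddCommMonoid S] (P : AddSemigroupIdeal S) : Prop :=
  (0 : S) ∉ P ∧ ∀ a b : S, a + b ∈ P → a ∈ P ∨ b ∈ P

/-- The minimal non-empty prime ideals of a commutative additive monoid. -/
def minimalPrimeIdeals (S : Type*) [AddCommMonoid S] : Set (AddSemigroupIdeal S) :=
  {P | Minimal (fun I => IsPrimeIdeal I ∧ (I : Set S).Nonempty) P}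

/-- The localization of a monoid `S` at a prime ideal `P`, inside the quotient group of `S`:
all differences `a - b` with `a ∈ S` and `b ∈ S \ P`. -/
def monoidLocalization {S : Type*} [AddCommMonoid S] (P : AddSemigroupIdeal S) :
    Set (Algebra.GrothendieckAddGroup S) :=
  {x | ∃ a b : S, b ∉ P ∧
    x = Algebra.GrothendieckAddGroup.of a - Algebra.GrothendieckAddGroup.of b}

/-- A cancellative commutative monoid `S` is weakly Krull if `S` is the intersection, inside its
quotient group, of its localizations at the minimal non-empty prime ideals (the empty
intersection being the quotient group), and every non-unit lies in only finitely many minimal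
non-empty prime ideals. -/
def IsWeaklyKrullMonoid (S : Type*) [AddCommMonoid S] [IsCancelAdd S] : Prop :=
  (⋂ P ∈ minimalPrimeIdeals S, monoidLocalization P) =
    Set.range (Algebra.GrothendieckAddGroup.of : S → Algebra.GrothendieckAddGroup S) ∧
  ∀ a : S, ¬ IsAddUnit a → {P ∈ minimalPrimeIdeals S | a ∈ P}.Finite

/-- For an ideal `P` of `D`, the ideal `P[S]` of `D[S]` of all elements with coefficients
in `P`. -/
def coeffIdeal {D : Type*} [CommRing D] (S : Type*) [AddCommMonoid S] (P : Ideal D) :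
    Ideal D[S] where
  carrier := {f | ∀ s, f.coeff s ∈ P}
  zero_mem' := fun s => by simp
  add_mem' := fun {f g} hf hg s => by simpa using P.add_mem (hf s) (hg s)
  smul_mem' := fun f g hg s => by
    classical
    rw [smul_eq_mul, AddMonoidAlgebra.coeff_mul]
    refine sum_mem fun a _ => sum_mem fun b _ => ?_
    dsimp only
    split_ifs
    · exact P.mul_mem_left _ (hg b)
    · exact P.zero_mem

/-- A domain `D` with quotient field `K` is `S`-UMT, for a torsion-free (cancellative,
commutative) monoid `S`, if the height-one primes of `D[S]` are exactly the ideals `P[S]` with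
`P` a height-one prime of `D` and the contractions `Q ∩ D[S]` with `Q` a height-one prime of
`K[S]`. -/
def IsUMT (D : Type*) [CommRing D] [IsDomain D]
    (S : Type*) [AddCommMonoid S] [IsCancelAdd S] [IsAddTorsionFree S] : Prop :=
  PrimeSpectrum.asIdeal '' heightOnePrimes D[S] =
    {I : Ideal D[S] | ∃ P ∈ heightOnePrimes D, I = coeffIdeal S P.asIdeal} ∪
    {I : Ideal D[S] | ∃ Q ∈ heightOnePrimes (FractionRing D)[S],
      I = Q.asIdeal.comap
        (AddMonoidAlgebra.mapRingHom S (algebraMap D (FractionRing D)))}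

/-- The ascending chain condition on cyclic subgroups of an additive group. -/
def ACCCyclicSubgroups (G : Type*) [AddGroup G] : Prop :=
  ∀ H : ℕ →o AddSubgroup G, (∀ n, IsAddCyclic (H n)) → ∃ N, ∀ n, N ≤ n → H n = H N

end WeaklyKrull

namespace WeaklyKrull

open AddMonoidAlgebra

/-! ### Weakly Krull domains through divisibility, height-one primes and localization -/

section Rings

/-! Let `K` be the quotient field of `D` and write `X^s` for `single s 1`. The theorem is assembled
from three facts.

(1) `D[G]` is weakly Krull iff `D` is weakly Krull and `G`-UMT
(`isWeaklyKrullDomain_groupAlgebra_iff`). A height-one prime of `D[G]` either meets `D` in a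
non-zero ideal, and is then some `P[G]`, or comes from `K[G]`. If `D[G]` is weakly Krull, prime
avoidance forces every `P[G]` to have height one, and divisibility descends to `D`. Conversely, a
Gauss-type lemma controls the coefficients of a quotient at each `P`, and `K[G]` itself is weakly
Krull because it is factorial. Factoriality is where the chain condition enters. Irreducibles are
prime since any relation lives over a finitely generated subgroup, where the algebra is a Laurent
polynomial ring. Factorizations terminate since edges of Newton polytopes have lengths that add
under multiplication and, for divisors of a fixed `f`, are multiples of one generator per edge
(`exists_additive_length`).

(2) `S` is weakly Krull iff `G` is Archimedean (`isWeaklyKrullMonoid_nonneg_iff`).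

(3) If `D[S]` is weakly Krull, then `G` is Archimedean (`archimedean_of_isWeaklyKrullDomain`). If
`G` is Archimedean, the height-one primes of `D[S]` are those of its localization `D[G]` and, when
`S` is non-trivial, the ideal of elements without constant term. The order of vanishing controls
divisibility at this extra prime, so `D[S]` and `D[G]` are weakly Krull simultaneously. -/

theorem mem_ofField_primeCompl_iff {R : Type*} [CommRing R] [IsDomain R] (P : PrimeSpectrum R)
    (a b : R) (hb : b ≠ 0) :
    algebraMap R (FractionRing R) a / algebraMap R (FractionRing R) b ∈
      Localization.subalgebra.ofField (FractionRing R)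
        P.asIdeal.primeCompl P.asIdeal.primeCompl_le_nonZeroDivisors ↔
    ∃ s, s ∉ P.asIdeal ∧ b ∣ s * a := by
  have hb' : algebraMap R (FractionRing R) b ≠ 0 := by simpa using hb
  constructor
  · rintro ⟨c, s, hs, h⟩
    have hs0 : s ≠ 0 := fun h0 => hs (h0 ▸ P.asIdeal.zero_mem)
    have hs' : algebraMap R (FractionRing R) s ≠ 0 := by simpa using hs0
    refine ⟨s, hs, c, ?_⟩
    apply IsFractionRing.injective R (FractionRing R)
    field_simp at h
    simp only [map_mul]
    rw [mul_comm, h]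
  · rintro ⟨s, hs, c, h⟩
    have hs0 : s ≠ 0 := fun h0 => hs (h0 ▸ P.asIdeal.zero_mem)
    have hs' : algebraMap R (FractionRing R) s ≠ 0 := by simpa using hs0
    refine ⟨c, s, hs, ?_⟩
    have := congrArg (algebraMap R (FractionRing R)) h
    simp only [map_mul] at this
    field_simp
    rw [mul_comm, this]

/-- A weakly Krull domain in terms of divisibility. -/
theorem isWeaklyKrullDomain_iff {R : Type*} [CommRing R] [IsDomain R] :
    IsWeaklyKrullDomain R ↔
      (∀ a b : R, b ≠ 0 →
        (∀ P ∈ heightOnePrimes R, ∃ s, s ∉ P.asIdeal ∧ b ∣ s * a) → b ∣ a) ∧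
      ∀ a : R, a ≠ 0 → ¬ IsUnit a → {P ∈ heightOnePrimes R | a ∈ P.asIdeal}.Finite := by
  refine and_congr_left fun _ => ?_
  constructor
  · intro h a b hb hP
    have hb' : algebraMap R (FractionRing R) b ≠ 0 := by simpa using hb
    have hmem : algebraMap R (FractionRing R) a / algebraMap R (FractionRing R) b ∈
        (⊥ : Subalgebra R (FractionRing R)) := by
      rw [← h]
      simp only [Algebra.mem_iInf]
      exact fun P hPX => (mem_ofField_primeCompl_iff P a b hb).2 (hP P hPX)
    obtain ⟨c, hc⟩ := Algebra.mem_bot.1 hmem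
    refine ⟨c, IsFractionRing.injective R (FractionRing R) ?_⟩
    rw [map_mul, hc]
    field_simp
  · intro h
    refine le_antisymm (fun x hx => ?_) bot_le
    obtain ⟨a, b, hb, rfl⟩ := IsFractionRing.div_surjective R x
    have hb0 : b ≠ 0 := nonZeroDivisors.ne_zero hb
    have hb' : algebraMap R (FractionRing R) b ≠ 0 := by simpa using hb0
    simp only [Algebra.mem_iInf] at hx
    obtain ⟨c, rfl⟩ := h a b hb0 fun P hP => (mem_ofField_primeCompl_iff P a b hb0).1 (hx P hP)
    refine Algebra.mem_bot.2 ⟨c, ?_⟩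
    rw [map_mul]
    field_simp

theorem eq_of_le_of_height_eq_one {R : Type*} [CommRing R] [IsDomain R] {P Q : Ideal R}
    [Q.IsPrime] [P.IsPrime] (hP : P.height = 1) (hQ : Q ≠ ⊥) (h : Q ≤ P) : Q = P := by
  by_contra hne
  have : Q.FiniteHeight :=
    ⟨Or.inr fun htop => by simpa [hP, htop] using Ideal.height_mono h⟩
  have h1 := Ideal.height_strict_mono_of_isPrime (lt_of_le_of_ne h hne)
  rw [hP] at h1
  exact hQ (Ideal.height_eq_zero_iff_eq_bot.1 (Order.lt_one_iff.1 h1))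

theorem height_eq_one_of_forall {R : Type*} [CommRing R] [IsDomain R] {P : Ideal R}
    [P.IsPrime] (h0 : P ≠ ⊥) (h : ∀ Q : Ideal R, Q.IsPrime → Q ≠ ⊥ → Q ≤ P → Q = P) :
    P.height = 1 := by
  apply le_antisymm
  · refine Ideal.height_le_iff.2 fun Q hQ hlt => ?_
    by_cases hQ0 : Q = ⊥
    · subst hQ0; simp
    · exact absurd (h Q hQ hQ0 hlt.le) hlt.ne
  · exact Order.one_le_iff_ne_zero.2 fun h1 => h0 (Ideal.height_eq_zero_iff_eq_bot.1 h1)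

/-- In the localization at `P` the maximal ideal is the only non-zero prime, so a power of `b` is
divisible by `a` there. Concretely, a prime containing `a` and avoiding both `b` and the complement
of `P` would lie strictly between `⊥` and `P`. -/
theorem exists_dvd_mul_pow_of_height_eq_one {R : Type*} [CommRing R] [IsDomain R] {P : Ideal R}
    [hPp : P.IsPrime] (hP : P.height = 1) {a b : R} (ha : a ≠ 0) (hb : b ∈ P) :
    ∃ (n : ℕ) (c : R), c ∉ P ∧ a ∣ c * b ^ n := by
  by_contra! hcon
  have hdisj : Disjoint (Ideal.span {a} : Set R)
      ((P.primeCompl ⊔ Submonoid.powers b : Submonoid R) : Set R) := by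
    rw [Set.disjoint_left]
    intro x hx hxM
    obtain ⟨c, hc, d, ⟨n, rfl⟩, rfl⟩ := Submonoid.mem_sup.1 hxM
    exact hcon n c hc (Ideal.mem_span_singleton.1 hx)
  obtain ⟨Q, hQ, hle, hd⟩ := Ideal.exists_le_prime_disjoint _ _ hdisj
  have haQ : a ∈ Q := hle (Ideal.mem_span_singleton_self a)
  have hQP : Q ≤ P := by
    intro x hx
    by_contra hxP
    exact Set.disjoint_left.1 hd hx
      ((le_sup_left : P.primeCompl ≤ P.primeCompl ⊔ Submonoid.powers b) hxP)
  have hbQ : b ∉ Q := fun h => Set.disjoint_left.1 hd h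
    ((le_sup_right : Submonoid.powers b ≤ P.primeCompl ⊔ Submonoid.powers b)
      (Submonoid.mem_powers b))
  have := eq_of_le_of_height_eq_one hP (Q := Q) (fun h => ha (by simpa [h] using haQ)) hQP
  exact hbQ (this ▸ hb)

section Localization

variable {A B : Type*} [CommRing A] [CommRing B] [Algebra A B] (M : Submonoid A)
  [IsLocalization M B]

include M in
theorem comap_mem_heightOnePrimes {Q : PrimeSpectrum B} (hQ : Q ∈ heightOnePrimes B) :
    PrimeSpectrum.comap (algebraMap A B) Q ∈ heightOnePrimes A :=
  (IsLocalization.height_under M Q.asIdeal).trans hQ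

theorem exists_comap_eq_of_disjoint {P : PrimeSpectrum A} (hP : P ∈ heightOnePrimes A)
    (hd : Disjoint (M : Set A) P.asIdeal) :
    ∃ Q ∈ heightOnePrimes B, Q.asIdeal.comap (algebraMap A B) = P.asIdeal := by
  have hpr := IsLocalization.isPrime_of_isPrime_disjoint M B P.asIdeal P.2 hd
  have hc := IsLocalization.under_map_of_isPrime_disjoint M B P.2 hd
  refine ⟨⟨_, hpr⟩, ?_, hc⟩
  have := IsLocalization.height_under M (P.asIdeal.map (algebraMap A B))
  rw [hc] at this
  exact this.symm.trans hP

end Localization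

/-- A unique factorization domain is weakly Krull. -/
theorem isWeaklyKrullDomain_of_uniqueFactorizationMonoid (R : Type*) [CommRing R] [IsDomain R]
    [UniqueFactorizationMonoid R] : IsWeaklyKrullDomain R := by
  have hspan : ∀ p : R, Prime p → (Ideal.span {p}).height = 1 := by
    intro p hp
    have := (Ideal.span_singleton_prime hp.ne_zero).2 hp
    refine height_eq_one_of_forall (by simpa using hp.ne_zero) fun Q hQ hQ0 hle => ?_
    obtain ⟨q, hqQ, hq⟩ := Ideal.IsPrime.exists_mem_prime_of_ne_bot hQ hQ0
    refine le_antisymm hle ?_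
    have hpq := Ideal.mem_span_singleton.1 (hle hqQ)
    have := (hp.associated_of_dvd hq hpq)
    rw [Ideal.span_singleton_eq_span_singleton.2 this]
    simpa [Ideal.span_le] using hqQ
  rw [isWeaklyKrullDomain_iff]
  constructor
  · intro a b hb h
    -- Once the fraction is reduced, a prime factor of the denominator spans a height-one prime at
    -- which the hypothesis fails.
    obtain ⟨a', b', c, hrel, rfl, rfl⟩ :=
      UniqueFactorizationMonoid.exists_reduced_factors' a b hb
    have hc : c ≠ 0 := left_ne_zero_of_mul hb
    have hb' : b' ≠ 0 := right_ne_zero_of_mul hb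
    have hu : IsUnit b' := by
      by_contra hu
      obtain ⟨p, hp, hpb⟩ := WfDvdMonoid.exists_irreducible_factor hu hb'
      rw [UniqueFactorizationMonoid.irreducible_iff_prime] at hp
      have hpr := (Ideal.span_singleton_prime hp.ne_zero).2 hp
      obtain ⟨s, hs, hd⟩ := h ⟨_, hpr⟩ (hspan p hp)
      have h1 : b' ∣ s * a' := by
        rw [mul_left_comm] at hd
        exact (mul_dvd_mul_iff_left hc).1 hd
      have h2 : p ∣ s := by
        rcases hp.dvd_or_dvd (hpb.trans h1) with h | h
        · exact h
        · exact absurd (hrel h hpb) hp.not_isUnit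
      exact hs (Ideal.mem_span_singleton.2 h2)
    exact mul_dvd_mul_left _ hu.dvd
  · intro a ha _
    classical
    refine Set.Finite.of_finite_image (f := PrimeSpectrum.asIdeal)
      (((UniqueFactorizationMonoid.factors a).toFinset.finite_toSet.image
        fun p => Ideal.span {p}).subset ?_) (fun P _ Q _ h => PrimeSpectrum.ext h)
    rintro _ ⟨P, ⟨hP, haP⟩, rfl⟩
    have hfp := UniqueFactorizationMonoid.factors_prod ha
    have : (UniqueFactorizationMonoid.factors a).prod ∈ P.asIdeal := by
      obtain ⟨u, hu⟩ := hfp.symm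
      rw [← hu]
      exact P.asIdeal.mul_mem_right _ haP
    obtain ⟨p, hp, hpP⟩ := (Ideal.IsPrime.multiset_prod_mem_iff_exists_mem P.2 _).1 this
    have hpp := UniqueFactorizationMonoid.prime_of_factor p hp
    have hpr := (Ideal.span_singleton_prime hpp.ne_zero).2 hpp
    refine ⟨p, by simpa using hp, ?_⟩
    refine eq_of_le_of_height_eq_one hP (by simpa using hpp.ne_zero) ?_
    simpa [Ideal.span_le] using hpP

end Rings

/-! ### Leading exponents with respect to a map into an ordered set or group -/

section Top

variable {R A Γ : Type*} [CommRing R] [AddCommMonoid A] [LinearOrder Γ]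

/-- The element of the support of `f` at which `D` is maximal. -/
noncomputable def top (D : A → Γ) (f : R[A]) : A :=
  open Classical in
  if h : f.coeff.support.Nonempty then (f.coeff.support.exists_max_image D h).choose else 0

theorem support_nonempty {f : R[A]} (hf : f ≠ 0) : f.coeff.support.Nonempty := by
  rwa [Finsupp.support_nonempty_iff, Ne, AddMonoidAlgebra.coeff_eq_zero]

theorem coeff_top_ne_zero (D : A → Γ) {f : R[A]} (hf : f ≠ 0) : f.coeff (top D f) ≠ 0 := by
  rw [top, dif_pos (support_nonempty hf)]
  exact Finsupp.mem_support_iff.1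
    (f.coeff.support.exists_max_image D (support_nonempty hf)).choose_spec.1

theorem le_top (D : A → Γ) {f : R[A]} {a : A} (ha : f.coeff a ≠ 0) : D a ≤ D (top D f) := by
  have hne : f.coeff.support.Nonempty := ⟨a, Finsupp.mem_support_iff.2 ha⟩
  rw [top, dif_pos hne]
  exact (f.coeff.support.exists_max_image D hne).choose_spec.2 a (Finsupp.mem_support_iff.2 ha)

theorem ne_zero_of_coeff_ne_zero {f : R[A]} {a : A} (ha : f.coeff a ≠ 0) : f ≠ 0 := by
  rintro rfl
  simp at ha

theorem eq_top {D : A → Γ} (hD : Function.Injective D) {f : R[A]} {a : A} (ha : f.coeff a ≠ 0)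
    (hmax : ∀ b, f.coeff b ≠ 0 → D b ≤ D a) : top D f = a :=
  hD (le_antisymm (hmax _ (coeff_top_ne_zero D (ne_zero_of_coeff_ne_zero ha))) (le_top D ha))

theorem exists_of_coeff_mul_ne_zero {f g : R[A]} {a : A} (h : (f * g).coeff a ≠ 0) :
    ∃ b c, f.coeff b ≠ 0 ∧ g.coeff c ≠ 0 ∧ b + c = a := by
  classical
  have := AddMonoidAlgebra.support_coeff_mul_subset f g (Finsupp.mem_support_iff.2 h)
  obtain ⟨b, hb, c, hc, rfl⟩ := Finset.mem_add.1 this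
  exact ⟨b, c, Finsupp.mem_support_iff.1 hb, Finsupp.mem_support_iff.1 hc, rfl⟩

/-- Injectivity of `D` makes the pair of leading exponents the only one in the supports with this
sum. -/
theorem coeff_mul_top_add_top [AddCommGroup Γ] [IsOrderedAddMonoid Γ] (D : A →+ Γ) (hD : Function.Injective D) (f g : R[A]) :
    (f * g).coeff (top D f + top D g) = f.coeff (top D f) * g.coeff (top D g) := by
  refine coeff_mul_add_of_uniqueAdd fun a b ha hb h => ?_
  have h1 := le_top D (Finsupp.mem_support_iff.1 ha)
  have h2 := le_top D (Finsupp.mem_support_iff.1 hb)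
  have h3 := congrArg D h
  simp only [map_add] at h3
  constructor
  · refine hD (le_antisymm h1 ?_)
    by_contra hlt
    exact absurd h3 (add_lt_add_of_lt_of_le (not_le.1 hlt) h2).ne
  · refine hD (le_antisymm h2 ?_)
    by_contra hlt
    exact absurd h3 (add_lt_add_of_le_of_lt h1 (not_le.1 hlt)).ne

theorem top_mul [IsDomain R] [AddCommGroup Γ] [IsOrderedAddMonoid Γ] (D : A →+ Γ) (hD : Function.Injective D) {f g : R[A]} (hf : f ≠ 0)
    (hg : g ≠ 0) : top D (f * g) = top D f + top D g := by
  refine eq_top hD ?_ fun a ha => ?_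
  · rw [coeff_mul_top_add_top D hD]
    exact mul_ne_zero (coeff_top_ne_zero D hf) (coeff_top_ne_zero D hg)
  · obtain ⟨b, c, hb, hc, rfl⟩ := exists_of_coeff_mul_ne_zero ha
    rw [map_add, map_add]
    exact add_le_add (le_top D hb) (le_top D hc)

theorem top_single {D : A → Γ} (hD : Function.Injective D) (a : A) {r : R} (hr : r ≠ 0) :
    top D (single a r) = a := by
  classical
  refine eq_top hD (by simpa using hr) fun b hb => ?_
  have : a = b := by
    by_contra hne
    simp [hne] at hb
  rw [this]

end Top

/-! ### Inverting the monomials -/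

section Loc

variable (R : Type*) [CommRing R]

/-- The monomials with coefficient one. -/
noncomputable def monomials (A : Type*) [AddCommMonoid A] : Submonoid R[A] :=
  MonoidHom.mrange (AddMonoidAlgebra.of R A)

theorem mem_monomials {A : Type*} [AddCommMonoid A] {x : R[A]} :
    x ∈ monomials R A ↔ ∃ a, single a 1 = x := by
  constructor
  · rintro ⟨a, rfl⟩
    exact ⟨a.toAdd, rfl⟩
  · rintro ⟨a, rfl⟩
    exact ⟨Multiplicative.ofAdd a, rfl⟩

theorem isUnit_single {K B : Type*} [CommRing K] [AddCommGroup B] (b : B) {r : K}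
    (hr : IsUnit r) : IsUnit (single b r : K[B]) := by
  obtain ⟨s, hs⟩ := hr.exists_right_inv
  refine IsUnit.of_mul_eq_one (single (-b) s) ?_
  rw [single_mul_single, hs, add_neg_cancel, one_def]

/-- Serves both for Laurent polynomials over polynomials and for `D[G]` over `D[S]`. -/
theorem isLocalization_mapDomainRingHom {A B : Type*} [AddCommMonoid A] [AddCommGroup B]
    (j : A →+ B) (hj : Function.Injective j) (hs : ∀ b, ∃ a a', b + j a = j a') :
    letI := (mapDomainRingHom R j).toAlgebra
    IsLocalization (monomials R A) R[B] := by
  let := (mapDomainRingHom R j).toAlgebra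
  have halg : ∀ x, algebraMap R[A] R[B] x = mapDomain j x := fun _ => rfl
  refine ⟨?_, ?_, ?_⟩
  · rintro ⟨x, hx⟩
    obtain ⟨a, rfl⟩ := (mem_monomials R).1 hx
    simp only [halg, mapDomain_single]
    exact isUnit_single _ isUnit_one
  · intro z
    suffices h : ∃ (a : A) (x : R[A]), z * single (j a) 1 = mapDomain j x by
      obtain ⟨a, x, h⟩ := h
      refine ⟨⟨x, ⟨single a 1, (mem_monomials R).2 ⟨a, rfl⟩⟩⟩, ?_⟩
      simp only [halg, mapDomain_single]
      exact h
    induction z using AddMonoidAlgebra.induction_linear with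
    | zero => exact ⟨0, 0, by simp⟩
    | add f g hf hg =>
      obtain ⟨a, x, hx⟩ := hf
      obtain ⟨b, y, hy⟩ := hg
      refine ⟨a + b, x * single b 1 + y * single a 1, ?_⟩
      rw [mapDomain_add, mapDomain_mul, mapDomain_mul, ← hx, ← hy, mapDomain_single,
        mapDomain_single, mul_assoc, mul_assoc, single_mul_single, single_mul_single, map_add,
        add_comm (j b) (j a), one_mul, add_mul]
    | single b r =>
      obtain ⟨a, a', h⟩ := hs b
      exact ⟨a, single a' r, by rw [single_mul_single, h, mapDomain_single, mul_one]⟩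
  · intro x y h
    exact ⟨1, by rw [mapDomain_injective hj h]⟩

end Loc

/-! ### Units and prime elements of `K[G]` -/

section PrimeElements

theorem uniqueFactorizationMonoid_of_basis (K : Type*) [Field K] {H : Type*} [AddCommGroup H]
    {n : ℕ} (e : H ≃+ (Fin n →₀ ℤ)) : UniqueFactorizationMonoid K[H] := by
  let j : (Fin n →₀ ℕ) →+ H := e.symm.toAddMonoidHom.comp
    (Finsupp.mapRange.addMonoidHom (Nat.castAddMonoidHom ℤ))
  have hj : Function.Injective j := e.symm.injective.comp
    (Finsupp.mapRange_injective _ (map_zero _) (Nat.cast_injective (R := ℤ)))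
  have hs : ∀ b, ∃ a a', b + j a = j a' := by
    intro b
    refine ⟨(e b).mapRange (fun z => (-z).toNat) (by simp),
      (e b).mapRange Int.toNat (by simp), e.injective ?_⟩
    simp only [j, AddMonoidHom.comp_apply, map_add]
    ext i
    simp
    omega
  let := (mapDomainRingHom K j).toAlgebra
  have := isLocalization_mapDomainRingHom K j hj hs
  have hu : UniqueFactorizationMonoid K[Fin n →₀ ℕ] :=
    inferInstanceAs (UniqueFactorizationMonoid (MvPolynomial (Fin n) K))
  exact UniqueFactorizationMonoid.of_isLocalization (monomials K (Fin n →₀ ℕ)) K[H]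

theorem uniqueFactorizationMonoid_of_fg (K : Type*) [Field K] {G : Type*} [AddCommGroup G]
    [IsAddTorsionFree G] (H : AddSubgroup G) (hH : H.FG) : UniqueFactorizationMonoid K[H] := by
  have h1 : Module.Finite ℤ H := by
    rw [Module.Finite.iff_addGroup_fg]
    exact (AddGroup.fg_iff_addSubgroup_fg H).2 hH
  have h3 : Module.Free ℤ H := inferInstance
  exact uniqueFactorizationMonoid_of_basis K
    ((Module.finBasis ℤ H).repr.toAddEquiv)

variable {K G : Type*} [Field K] [AddCommGroup G] [LinearOrder G] [IsOrderedAddMonoid G]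

/-- If `f * f' = 1`, the greatest exponents of `f` and `f'` sum to zero, and so do the least ones;
hence the greatest exponent of `f` is at most the least. -/
theorem isUnit_iff_exists_single {f : K[G]} : IsUnit f ↔ ∃ g r, r ≠ 0 ∧ f = single g r := by
  constructor
  · intro h
    obtain ⟨f', hf'⟩ := h.exists_right_inv
    have h0 : f ≠ 0 := h.ne_zero
    have h0' : f' ≠ 0 := by rintro rfl; simp at hf'
    have h1 := top_mul (AddMonoidHom.id G) Function.injective_id h0 h0'
    have h2 := top_mul (-AddMonoidHom.id G) neg_injective h0 h0'
    have e1 : top (AddMonoidHom.id G) (1 : K[G]) = 0 := top_single Function.injective_id 0 one_ne_zero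
    have e2 : top (-AddMonoidHom.id G) (1 : K[G]) = 0 := top_single neg_injective 0 one_ne_zero
    rw [hf', e1] at h1
    rw [hf', e2] at h2
    have a1 : ∀ {x : K[G]} {g}, x.coeff g ≠ 0 → g ≤ top (AddMonoidHom.id G) x :=
      fun hg => le_top (AddMonoidHom.id G) hg
    have a2 : ∀ {x : K[G]} {g}, x.coeff g ≠ 0 → top (-AddMonoidHom.id G) x ≤ g :=
      fun hg => by simpa using le_top (-AddMonoidHom.id G) hg
    have a3 := a2 (coeff_top_ne_zero (AddMonoidHom.id G) h0')
    refine ⟨top (AddMonoidHom.id G) f, f.coeff (top (AddMonoidHom.id G) f),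
      coeff_top_ne_zero _ h0, ?_⟩
    ext g
    by_cases hg : g = top (AddMonoidHom.id G) f
    · rw [hg]; simp
    · have : f.coeff g = 0 := by
        by_contra hne
        refine hg (le_antisymm (a1 hne) ?_)
        have := a2 hne
        have h3 : top (AddMonoidHom.id G) f = - top (AddMonoidHom.id G) f' :=
          eq_neg_of_add_eq_zero_left h1.symm
        have h4 : top (-AddMonoidHom.id G) f = - top (-AddMonoidHom.id G) f' :=
          eq_neg_of_add_eq_zero_left h2.symm
        rw [h3]
        refine le_trans (neg_le_neg a3) ?_
        rw [← h4]
        exact this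
      rw [this, coeff_single, Finsupp.single_eq_of_ne hg]
  · rintro ⟨g, r, hr, rfl⟩
    exact isUnit_single g (isUnit_iff_ne_zero.2 hr)

/-- A relation `a * b = p * c` involves finitely many exponents, so it holds in `K[H]` with `H`
finitely generated and free, which is factorial. Units of `K[G]` are monomials, so `p` stays
irreducible in `K[H]`. -/
theorem prime_of_irreducible {p : K[G]} (hp : Irreducible p) : Prime p := by
  classical
  refine ⟨hp.ne_zero, hp.not_isUnit, fun a b ⟨c, hc⟩ => ?_⟩
  obtain ⟨F, hFp, hFa, hFb, hFc⟩ : ∃ F : Finset G, p.coeff.support ⊆ F ∧ a.coeff.support ⊆ F ∧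
      b.coeff.support ⊆ F ∧ c.coeff.support ⊆ F :=
    ⟨p.coeff.support ∪ a.coeff.support ∪ b.coeff.support ∪ c.coeff.support,
      by intro; simp +contextual, by intro; simp +contextual, by intro; simp +contextual,
      by intro; simp +contextual⟩
  let H : AddSubgroup G := AddSubgroup.closure F
  have hfg : H.FG := ⟨F, rfl⟩
  have := uniqueFactorizationMonoid_of_fg K H hfg
  have hinj : Function.Injective H.subtype := H.subtype_injective
  let ι : K[H] →+* K[G] := mapDomainRingHom K H.subtype
  have hι : Function.Injective ι := mapDomain_injective hinj
  have hlift : ∀ x : K[G], x.coeff.support ⊆ F → ∃ y, ι y = x := fun x hx =>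
    ⟨comapDomain H.subtype hinj x, mapDomain_comapDomain (by
      intro g hg
      exact ⟨⟨g, AddSubgroup.subset_closure (hx hg)⟩, rfl⟩) _⟩
  obtain ⟨p, rfl⟩ := hlift p hFp
  obtain ⟨a, rfl⟩ := hlift a hFa
  obtain ⟨b, rfl⟩ := hlift b hFb
  obtain ⟨c, rfl⟩ := hlift c hFc
  have hunit : ∀ x, IsUnit (ι x) → IsUnit x := by
    intro x hx
    obtain ⟨g, r, hr, h⟩ := isUnit_iff_exists_single.1 hx
    have hx0 : x ≠ 0 := by rintro rfl; simp at hx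
    obtain ⟨k, hk⟩ := support_nonempty hx0
    have h1 : (ι x).coeff (k : G) = x.coeff k := Finsupp.mapDomain_apply hinj x.coeff k
    have h2 : g = k := by
      by_contra hne
      rw [h] at h1
      simp [hne] at h1
      exact Finsupp.mem_support_iff.1 hk h1.symm
    have h3 : x = single k r := hι (by rw [h, h2]; exact (mapDomain_single).symm)
    rw [h3]
    exact isUnit_single k (isUnit_iff_ne_zero.2 hr)
  have hirr : Irreducible p := by
    refine ⟨fun h => hp.not_isUnit (h.map ι), fun x y hxy => ?_⟩
    rcases hp.isUnit_or_isUnit (by rw [hxy, map_mul]) with h | h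
    · exact Or.inl (hunit _ h)
    · exact Or.inr (hunit _ h)
  rw [← map_mul, ← map_mul] at hc
  have hc' : a * b = p * c := hι hc
  rcases (UniqueFactorizationMonoid.irreducible_iff_prime.1 hirr).dvd_or_dvd ⟨c, hc'⟩ with h | h
  · exact Or.inl (map_dvd ι h)
  · exact Or.inr (map_dvd ι h)

end PrimeElements

/-! ### Rational functionals and the rank-one subgroup through an element -/

section Functionals

variable {G : Type*} [AddCommGroup G] [LinearOrder G] [IsOrderedAddMonoid G]

/-- In the divisible hull, a rational vector space, `x` lies on the line through `u`: otherwise some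
functional would vanish on `u` but not on `x`. -/
theorem exists_smul_eq_of_forall_functional {u x : G}
    (h : ∀ ψ : G →+ ℚ, ψ u = 0 → ψ x = 0) : ∃ (m : ℕ) (n : ℤ), 0 < m ∧ m • x = n • u := by
  let ι : G →+ DivisibleHull G := DivisibleHull.coeAddMonoidHom G
  have hι : Function.Injective ι := fun _ _ h => DivisibleHull.coe_injective h
  have hmem : ι x ∈ Submodule.span ℚ {ι u} := by
    by_contra hx
    obtain ⟨f, hf, hle⟩ := Submodule.exists_le_ker_of_notMem hx
    refine hf (h (f.toAddMonoidHom.comp ι) ?_)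
    exact hle (Submodule.mem_span_singleton_self _)
  obtain ⟨q, hq⟩ := Submodule.mem_span_singleton.1 hmem
  refine ⟨q.den, q.num, q.den_pos, hι ?_⟩
  rw [map_nsmul, map_zsmul, ← hq, ← Nat.cast_smul_eq_nsmul ℚ, ← Int.cast_smul_eq_zsmul ℚ, smul_smul,
    mul_comm, Rat.mul_den_eq_num]

theorem exists_functional_ne {x y : G} (h : x ≠ y) : ∃ ψ : G →+ ℚ, ψ x ≠ ψ y := by
  by_contra! hcon
  obtain ⟨m, n, hm, hmn⟩ := exists_smul_eq_of_forall_functional (u := 0) (x := x - y)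
    fun ψ _ => by rw [map_sub, hcon, sub_self]
  rw [smul_zero, smul_eq_zero_iff_right hm.ne'] at hmn
  exact h (sub_eq_zero.1 hmn)

/-- The elements of `G` on the rational line through `u` form a cyclic group: a maximal cyclic
subgroup containing `u` absorbs each of them. -/
theorem exists_zsmul_of_forall_functional (hG : ACCCyclicSubgroups G) {u : G} (hu : u ≠ 0) :
    ∃ w : G, 0 < w ∧ ∀ x, (∀ ψ : G →+ ℚ, ψ u = 0 → ψ x = 0) → ∃ k : ℤ, x = k • w := by
  let C := {H : AddSubgroup G // IsAddCyclic H}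
  have hwf : WellFoundedGT C := by
    rw [wellFoundedGT_iff_monotone_chain_condition]
    intro a
    obtain ⟨N, hN⟩ := hG ⟨fun n => (a n).1, fun m n h => a.monotone h⟩ fun n => (a n).2
    exact ⟨N, fun m hm => Subtype.ext (hN m hm).symm⟩
  have hcyc : ∀ w : G, IsAddCyclic (AddSubgroup.zmultiples w) := fun w => inferInstance
  obtain ⟨⟨H, hH⟩, huH, hmax⟩ := hwf.wf.has_min {H : C | u ∈ H.1}
    ⟨⟨AddSubgroup.zmultiples u, hcyc u⟩, AddSubgroup.mem_zmultiples u⟩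
  obtain ⟨w, rfl⟩ := (AddSubgroup.isAddCyclic_iff_exists_zmultiples_eq_top H).1 hH
  have huw : u ∈ AddSubgroup.zmultiples w := huH
  have hw : w ≠ 0 := by
    rintro rfl
    simp at huw
    exact hu huw
  have key : ∀ x, (∀ ψ : G →+ ℚ, ψ u = 0 → ψ x = 0) → ∃ k : ℤ, x = k • w := by
    intro x hx
    obtain ⟨m, n, hm, hmn⟩ := exists_smul_eq_of_forall_functional hx
    obtain ⟨k, rfl⟩ := AddSubgroup.mem_zmultiples_iff.1 huw
    rw [smul_smul, ← natCast_zsmul] at hmn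
    obtain ⟨g, m', l', hg, hcop, hm', hl'⟩ : ∃ g m' l' : ℤ, g ≠ 0 ∧ IsCoprime m' l' ∧
        (m : ℤ) = g * m' ∧ n * k = g * l' := by
      have hpos : 0 < Int.gcd m (n * k) := Int.gcd_pos_of_ne_zero_left _ (by exact_mod_cast hm.ne')
      obtain ⟨m', l', hc, h1, h2⟩ := Int.exists_gcd_one hpos
      exact ⟨_, m', l', by exact_mod_cast hpos.ne', Int.isCoprime_iff_gcd_eq_one.2 hc,
        h1.trans (mul_comm _ _), h2.trans (mul_comm _ _)⟩
    rw [hm', hl', mul_smul, mul_smul] at hmn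
    have h1 : m' • x = l' • w := smul_right_injective G hg hmn
    obtain ⟨α, β, hαβ⟩ := hcop
    -- By Bézout, `α • w + β • x` generates a cyclic group containing both `w` and `x`.
    have hzw : m' • (α • w + β • x) = w := by
      rw [smul_add, smul_comm m' β, h1, smul_smul, smul_smul, ← add_smul, mul_comm m', hαβ,
        one_smul]
    have hzx : l' • (α • w + β • x) = x := by
      rw [smul_add, smul_comm l' α, ← h1, smul_smul, smul_smul, ← add_smul, mul_comm l', hαβ,
        one_smul]
    have hle : AddSubgroup.zmultiples w ≤ AddSubgroup.zmultiples (α • w + β • x) :=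
      AddSubgroup.zmultiples_le_of_mem ⟨m', hzw⟩
    have hge : AddSubgroup.zmultiples (α • w + β • x) ≤ AddSubgroup.zmultiples w := by
      by_contra hnot
      exact hmax ⟨_, hcyc (α • w + β • x)⟩ (hle huw)
        (lt_of_le_not_ge hle hnot)
    obtain ⟨k, hk⟩ := AddSubgroup.mem_zmultiples_iff.1 (hge ⟨l', hzx⟩)
    exact ⟨k, hk.symm⟩
  rcases lt_or_gt_of_ne hw with h | h
  · refine ⟨-w, neg_pos.2 h, fun x hx => ?_⟩
    obtain ⟨k, hk⟩ := key x hx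
    exact ⟨-k, by rw [hk, neg_smul_neg]⟩
  · exact ⟨w, h, key⟩

end Functionals

/-! ### Exposed faces of finite sets of exponents -/

section Faces

variable {G : Type*} [AddCommGroup G]

/-- The points of `S` at which `φ` is maximal. -/
noncomputable def face (φ : G →+ ℚ) (S : Finset G) : Finset G :=
  open Classical in S.filter fun x => ∀ y ∈ S, φ y ≤ φ x

theorem mem_face {φ : G →+ ℚ} {S : Finset G} {x : G} :
    x ∈ face φ S ↔ x ∈ S ∧ ∀ y ∈ S, φ y ≤ φ x := by
  simp [face]

theorem face_subset (φ : G →+ ℚ) (S : Finset G) : face φ S ⊆ S := fun _ h => (mem_face.1 h).1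

/-- All differences of points of `T` are rational multiples of each other. -/
def Collinear (T : Finset G) : Prop :=
  ∀ x ∈ T, ∀ y ∈ T, x ≠ y → ∀ ψ : G →+ ℚ, ψ x = ψ y → ∀ z ∈ T, ∀ w ∈ T, ψ z = ψ w

theorem exists_face_eq_face_face (φ θ : G →+ ℚ) (S : Finset G) :
    ∃ φ' : G →+ ℚ, ∀ T ⊆ S, face φ' T = face θ (face φ T) := by
  -- With `N` this large, `N • φ + θ` orders points by `φ` first and uses `θ` only to break ties.
  obtain ⟨N, hN⟩ : ∃ N : ℕ, ∀ x ∈ S, ∀ y ∈ S, φ x < φ y → θ x - θ y < N * (φ y - φ x) := by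
    have : ∀ᶠ N : ℕ in Filter.atTop, ∀ x ∈ S, ∀ y ∈ S,
        φ x < φ y → θ x - θ y < N * (φ y - φ x) := by
      rw [Filter.eventually_all_finset]
      intro x _
      rw [Filter.eventually_all_finset]
      intro y _
      by_cases h : φ x < φ y
      · have h' := sub_pos.2 h
        obtain ⟨N, hN⟩ := exists_nat_gt ((θ x - θ y) / (φ y - φ x))
        filter_upwards [Filter.eventually_ge_atTop N] with n hn _
        rw [div_lt_iff₀ h'] at hN
        refine hN.trans_le (mul_le_mul_of_nonneg_right (by exact_mod_cast hn) h'.le)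
      · exact Filter.Eventually.of_forall fun n hn => absurd hn h
    exact this.exists
  refine ⟨N • φ + θ, fun T hT => ?_⟩
  have hval : ∀ x, (N • φ + θ) x = N * φ x + θ x := fun x => by simp
  have hmono : ∀ x ∈ T, ∀ y ∈ T, (N • φ + θ) x ≤ (N • φ + θ) y → φ x ≤ φ y := by
    intro x hx y hy h
    by_contra hlt
    have := hN y (hT hy) x (hT hx) (not_le.1 hlt)
    rw [hval, hval] at h
    linarith
  ext x
  simp only [mem_face]
  constructor
  · rintro ⟨hx, h⟩
    have h1 : ∀ y ∈ T, φ y ≤ φ x := fun y hy => hmono y hy x hx (h y hy)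
    refine ⟨⟨hx, h1⟩, fun y ⟨hy, hy'⟩ => ?_⟩
    have h2 := h y hy
    rw [hval, hval, le_antisymm (h1 y hy) (hy' x hx)] at h2
    linarith
  · rintro ⟨⟨hx, h1⟩, h2⟩
    refine ⟨hx, fun y hy => ?_⟩
    by_cases hlt : φ y < φ x
    · have := hN y (hT hy) x (hT hx) hlt
      rw [hval, hval]
      linarith
    · have heq : φ y = φ x := le_antisymm (h1 y hy) (not_lt.1 hlt)
      have := h2 y ⟨hy, fun z hz => heq ▸ h1 z hz⟩
      rw [hval, hval, heq]
      linarith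

/-- A set of points which is not contained in a line has a proper face with two points. -/
theorem exists_face_of_not_constant {T : Finset G} {ψ χ : G →+ ℚ} {x y z w : G} (hx : x ∈ T)
    (hy : y ∈ T) (hz : z ∈ T) (hw : w ∈ T) (hψ : ψ x = ψ y) (hχ : χ x ≠ χ y) (hzw : ψ z ≠ ψ w) :
    ∃ θ : G →+ ℚ, (∃ p ∈ face θ T, ∃ q ∈ face θ T, p ≠ q) ∧ face θ T ≠ T := by
  have hproper : ∀ θ : G →+ ℚ, ∀ a ∈ T, ∀ b ∈ T, θ a ≠ θ b → face θ T ≠ T := by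
    intro θ a ha b hb hab h
    rw [← h] at ha hb
    exact hab (le_antisymm ((mem_face.1 hb).2 a (mem_face.1 ha).1)
      ((mem_face.1 ha).2 b (mem_face.1 hb).1))
  obtain ⟨y0, hy0, hmin⟩ := T.exists_min_image ψ ⟨x, hx⟩
  by_cases hex : ∃ y1 ∈ T, y1 ≠ y0 ∧ ψ y1 = ψ y0
  · obtain ⟨y1, hy1, hne, he⟩ := hex
    refine ⟨-ψ, ⟨y1, mem_face.2 ⟨hy1, fun t ht => ?_⟩, y0, mem_face.2 ⟨hy0, fun t ht => ?_⟩, hne⟩,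
      hproper _ z hz w hw (by simpa using hzw)⟩
    · simpa [he] using hmin t ht
    · simpa using hmin t ht
  · push Not at hex
    have hlt : ∀ t ∈ T, t ≠ y0 → ψ y0 < ψ t := fun t ht hne =>
      lt_of_le_of_ne (hmin t ht) (hex t ht hne).symm
    have hne : ∃ t ∈ T, t ≠ y0 := by
      by_contra! h
      exact hzw (by rw [h z hz, h w hw])
    classical
    -- Here `y0` is the only minimum of `ψ`. The least ratio `s` tilts `χ` so that `χ + s • ψ` is
    -- maximal at `y0` and again at `t0`. It still separates `x` from `y`, where `ψ` agrees and `χ`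
    -- does not.
    obtain ⟨t0, ht0, hs⟩ := (T.filter (· ≠ y0)).exists_min_image
      (fun t => (χ y0 - χ t) / (ψ t - ψ y0))
      (by obtain ⟨t, ht, h⟩ := hne; exact ⟨t, by simp [ht, h]⟩)
    rw [Finset.mem_filter] at ht0
    set s := (χ y0 - χ t0) / (ψ t0 - ψ y0) with hsdef
    have hval : ∀ t, (χ + s • ψ : G →+ ℚ) t = χ t + s * ψ t := fun t => by simp
    have h0 : χ t0 + s * ψ t0 = χ y0 + s * ψ y0 := by
      have : ψ t0 - ψ y0 ≠ 0 := (sub_pos.2 (hlt t0 ht0.1 ht0.2)).ne'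
      rw [hsdef]
      field_simp
      ring
    have hle : ∀ t ∈ T, χ t + s * ψ t ≤ χ y0 + s * ψ y0 := by
      intro t ht
      by_cases hty : t = y0
      · rw [hty]
      · have h1 := hs t (by simp [ht, hty])
        rw [le_div_iff₀ (sub_pos.2 (hlt t ht hty))] at h1
        linarith
    refine ⟨χ + s • ψ, ⟨t0, mem_face.2 ⟨ht0.1, fun t ht => ?_⟩, y0,
      mem_face.2 ⟨hy0, fun t ht => ?_⟩, ht0.2⟩, hproper _ x hx y hy ?_⟩
    · rw [hval, hval, h0]; exact hle t ht
    · rw [hval, hval]; exact hle t ht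
    · rw [hval, hval, hψ]
      intro h
      exact hχ (by linarith)

end Faces

/-! ### Existence of edges -/

section Edges

variable {G : Type*} [AddCommGroup G] [LinearOrder G] [IsOrderedAddMonoid G]

/-- Used with `S` the support of a divisor and `T` that of its multiple. Among the `φ` whose face of
`S` has two points, take one minimizing the total size of both faces. A face off a line could be
refined further. -/
theorem exists_collinear_face (S T : Finset G) (hS : S.Nontrivial) :
    ∃ φ : G →+ ℚ, (face φ S).Nontrivial ∧ Collinear (face φ T) := by
  classical
  have hex : ∃ n : ℕ, ∃ φ : G →+ ℚ, (face φ S).Nontrivial ∧ (face φ S).card + (face φ T).card = n :=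
    ⟨_, 0, by rwa [show face 0 S = S by ext; simp [mem_face]], rfl⟩
  obtain ⟨φ, hφ, hcard⟩ := Nat.find_spec hex
  have hmin : ∀ φ' : G →+ ℚ, (face φ' S).Nontrivial →
      (face φ S).card + (face φ T).card ≤ (face φ' S).card + (face φ' T).card := fun φ' h => by
    rw [hcard]
    exact Nat.find_min' hex ⟨φ', h, rfl⟩
  have hred : ∀ θ : G →+ ℚ, (face θ (face φ S)).Nontrivial →
      face θ (face φ S) = face φ S ∧ face θ (face φ T) = face φ T := by
    intro θ hθ
    obtain ⟨φ', h⟩ := exists_face_eq_face_face φ θ (S ∪ T)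
    have h1 := h S Finset.subset_union_left
    have h2 := h T Finset.subset_union_right
    have := hmin φ' (h1 ▸ hθ)
    rw [h1, h2] at this
    have c1 := Finset.card_le_card (face_subset θ (face φ S))
    have c2 := Finset.card_le_card (face_subset θ (face φ T))
    exact ⟨Finset.eq_of_subset_of_card_le (face_subset _ _) (by omega),
      Finset.eq_of_subset_of_card_le (face_subset _ _) (by omega)⟩
  have hcol : Collinear (face φ S) := by
    intro x hx y hy hxy ψ hψ z hz w hw
    by_contra hzw
    obtain ⟨χ, hχ⟩ := exists_functional_ne hxy
    obtain ⟨θ, ⟨p, hp, q, hq, hpq⟩, hne⟩ := exists_face_of_not_constant hx hy hz hw hψ hχ hzw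
    exact hne (hred θ ⟨p, hp, q, hq, hpq⟩).1
  refine ⟨φ, hφ, fun x hx y hy hxy ψ hψ z hz w hw => ?_⟩
  by_contra hzw
  obtain ⟨p, hp, q, hq, hpq⟩ := hφ
  -- This `θ` is constant on the face of `S`, already known to be collinear, but not on that of `T`,
  -- so it would shrink only the latter. If `ψ` separates `p` and `q`, subtracting a multiple of it
  -- from `χ` makes them agree.
  obtain ⟨θ, hθ, a, ha, b, hb, hab⟩ : ∃ θ : G →+ ℚ, θ p = θ q ∧
      ∃ a ∈ face φ T, ∃ b ∈ face φ T, θ a ≠ θ b := by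
    by_cases h : ψ p = ψ q
    · exact ⟨ψ, h, z, hz, w, hw, hzw⟩
    · obtain ⟨χ, hχ⟩ := exists_functional_ne hxy
      have hval : ∀ t, (χ - ((χ p - χ q) / (ψ p - ψ q)) • ψ : G →+ ℚ) t =
        χ t - ((χ p - χ q) / (ψ p - ψ q)) * ψ t := fun t => by simp
      refine ⟨χ - ((χ p - χ q) / (ψ p - ψ q)) • ψ, ?_, x, hx, y, hy, ?_⟩
      · have := sub_ne_zero.2 h
        rw [hval, hval]
        field_simp
        ring
      · rw [hval, hval, hψ]
        intro h
        exact hχ (by linarith)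
  have hconst := hcol p hp q hq hpq θ hθ
  have hfull : face θ (face φ S) = face φ S := by
    ext t
    rw [mem_face]
    exact ⟨fun h => h.1, fun h => ⟨h, fun s hs => (hconst s hs t h).le⟩⟩
  have := (hred θ (by rw [hfull]; exact ⟨p, hp, q, hq, hpq⟩)).2
  rw [← this] at ha hb
  exact hab (le_antisymm ((mem_face.1 hb).2 a (mem_face.1 ha).1)
    ((mem_face.1 ha).2 b (mem_face.1 hb).1))

end Edges

/-! ### Lengths of faces of Newton polytopes -/

section Length

variable {K G : Type*} [Field K] [AddCommGroup G]

/-- Compare first by `φ` and then by `D`. -/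
def lexHom {Γ : Type*} [AddCommGroup Γ] (φ : G →+ ℚ) (D : G →+ Γ) : G →+ ℚ ×ₗ Γ where
  toFun g := toLex (φ g, D g)
  map_zero' := by simp
  map_add' x y := by simp only [map_add]; rfl

theorem eq_of_mem_face {φ : G →+ ℚ} {S : Finset G} {x y : G} (hx : x ∈ face φ S)
    (hy : y ∈ face φ S) : φ x = φ y :=
  le_antisymm ((mem_face.1 hy).2 x (mem_face.1 hx).1) ((mem_face.1 hx).2 y (mem_face.1 hy).1)

section

variable {Γ : Type*} [AddCommGroup Γ] {D : G →+ Γ}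

theorem lexHom_injective (φ : G →+ ℚ) (hD : Function.Injective D) :
    Function.Injective (lexHom φ D) := fun _ _ h => hD (congrArg (fun x => (ofLex x).2) h)

variable [LinearOrder Γ]

theorem lexHom_le_iff {φ : G →+ ℚ} {x y : G} :
    lexHom φ D x ≤ lexHom φ D y ↔ φ x < φ y ∨ φ x = φ y ∧ D x ≤ D y :=
  Prod.Lex.toLex_le_toLex

theorem top_lexHom_mem_face (φ : G →+ ℚ) (D : G →+ Γ) {f : K[G]} (hf : f ≠ 0) :
    top (lexHom φ D) f ∈ face φ f.coeff.support := by
  refine mem_face.2 ⟨Finsupp.mem_support_iff.2 (coeff_top_ne_zero _ hf), fun y hy => ?_⟩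
  rcases lexHom_le_iff.1 (le_top (lexHom φ D) (Finsupp.mem_support_iff.1 hy)) with h | h
  · exact h.le
  · exact h.1.le

theorem le_top_lexHom {φ : G →+ ℚ} {f : K[G]} {x : G} (hx : x ∈ face φ f.coeff.support) :
    D x ≤ D (top (lexHom φ D) f) := by
  obtain ⟨hx, hx'⟩ := mem_face.1 hx
  have hx0 := Finsupp.mem_support_iff.1 hx
  rcases lexHom_le_iff.1 (le_top (lexHom φ D) hx0) with h | h
  · exact absurd h (not_lt.2 (hx' _ (Finsupp.mem_support_iff.2
      (coeff_top_ne_zero _ (ne_zero_of_coeff_ne_zero hx0)))))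
  · exact h.2

variable [LinearOrder G] [IsOrderedAddMonoid G] [IsOrderedAddMonoid Γ]

/-- The face of a product is governed by the faces of its factors. Equality of the summed
`φ'`-values, each bounded by its maximum, forces equality for each factor, so the leading point for
`φ` lies in the `φ'`-face. -/
theorem top_lexHom_congr {φ φ' : G →+ ℚ} (hD : Function.Injective D) {f g : K[G]} (hf : f ≠ 0)
    (hg : g ≠ 0) (h : face φ (f * g).coeff.support = face φ' (f * g).coeff.support) :
    top (lexHom φ D) f = top (lexHom φ' D) f := by
  have key : ∀ φ φ' : G →+ ℚ, face φ (f * g).coeff.support = face φ' (f * g).coeff.support →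
      D (top (lexHom φ D) f) ≤ D (top (lexHom φ' D) f) := by
    intro φ φ' h
    have h1 := top_lexHom_mem_face φ D (mul_ne_zero hf hg)
    have h2 := top_lexHom_mem_face φ' D (mul_ne_zero hf hg)
    rw [h] at h1
    have h3 := eq_of_mem_face h1 h2
    rw [top_mul _ (lexHom_injective φ hD) hf hg, top_mul _ (lexHom_injective φ' hD) hf hg,
      map_add, map_add] at h3
    have m1 := mem_face.1 (top_lexHom_mem_face φ' D hf)
    have m2 := mem_face.1 (top_lexHom_mem_face φ' D hg)
    have n1 := (mem_face.1 (top_lexHom_mem_face φ D hf)).1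
    have n2 := (mem_face.1 (top_lexHom_mem_face φ D hg)).1
    have l1 := m1.2 _ n1
    have l2 := m2.2 _ n2
    refine le_top_lexHom (mem_face.2 ⟨n1, fun y hy => ?_⟩)
    have := m1.2 y hy
    linarith
  exact hD (le_antisymm (key φ φ' h) (key φ' φ h.symm))

end

variable [LinearOrder G] [IsOrderedAddMonoid G]

/-- The greatest point of the `φ`-face of `f`. -/
noncomputable def hi (φ : G →+ ℚ) (f : K[G]) : G := top (lexHom φ (AddMonoidHom.id G)) f

/-- The least point of the `φ`-face of `f`. -/
noncomputable def lo (φ : G →+ ℚ) (f : K[G]) : G := top (lexHom φ (-AddMonoidHom.id G)) f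

/-- The length of the `φ`-face of `f` with respect to the order of `G`. -/
noncomputable def len (φ : G →+ ℚ) (f : K[G]) : G := hi φ f - lo φ f

theorem len_mul (φ : G →+ ℚ) {f g : K[G]} (hf : f ≠ 0) (hg : g ≠ 0) :
    len φ (f * g) = len φ f + len φ g := by
  rw [len, hi, lo, top_mul _ (lexHom_injective φ Function.injective_id) hf hg,
    top_mul _ (lexHom_injective φ neg_injective) hf hg, len, len, hi, lo, hi, lo]
  abel

theorem len_nonneg (φ : G →+ ℚ) {f : K[G]} (hf : f ≠ 0) : 0 ≤ len φ f :=
  sub_nonneg.2 (le_top_lexHom (D := AddMonoidHom.id G) (top_lexHom_mem_face φ _ hf))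

theorem len_pos {φ : G →+ ℚ} {f : K[G]} (h : (face φ f.coeff.support).Nontrivial) :
    0 < len φ f := by
  obtain ⟨x, hx, y, hy, hxy⟩ := h
  have hhi : ∀ z ∈ face φ f.coeff.support, z ≤ hi φ f := fun z hz =>
    le_top_lexHom (D := AddMonoidHom.id G) hz
  have hlo : ∀ z ∈ face φ f.coeff.support, lo φ f ≤ z := fun z hz => by
    simpa [lo] using le_top_lexHom (D := -AddMonoidHom.id G) hz
  rw [len, sub_pos]
  rcases lt_or_gt_of_ne hxy with h | h
  · exact (hlo x hx).trans_lt (h.trans_le (hhi y hy))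
  · exact (hlo y hy).trans_lt (h.trans_le (hhi x hx))

theorem len_congr {φ φ' : G →+ ℚ} {f g : K[G]} (hf : f ≠ 0)
    (hg : g ≠ 0) (h : face φ (f * g).coeff.support = face φ' (f * g).coeff.support) :
    len φ f = len φ' f := by
  rw [len, len, hi, hi, lo, lo, top_lexHom_congr Function.injective_id hf hg h,
    top_lexHom_congr neg_injective hf hg h]

/-- Each face of a factor is parallel to the edge of the product: a functional constant on the
product's edge is constant on the factors' faces. Hence the factor's length lies on the rational
line spanned by the length of the edge. -/
theorem functional_len_eq_zero {φ : G →+ ℚ} {f g : K[G]} (hf : f ≠ 0) (hg : g ≠ 0)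
    (hcol : Collinear (face φ (f * g).coeff.support))
    (hnt : (face φ (f * g).coeff.support).Nontrivial) {ψ : G →+ ℚ}
    (hψ : ψ (len φ (f * g)) = 0) : ψ (len φ f) = 0 := by
  have hfg := mul_ne_zero hf hg
  have hhi : hi φ (f * g) ∈ face φ (f * g).coeff.support := top_lexHom_mem_face φ _ hfg
  have hlo : lo φ (f * g) ∈ face φ (f * g).coeff.support := top_lexHom_mem_face φ _ hfg
  have hne : hi φ (f * g) ≠ lo φ (f * g) := (sub_pos.1 (len_pos hnt)).ne'
  rw [len, map_sub, sub_eq_zero] at hψ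
  have hconst := hcol _ hhi _ hlo hne ψ hψ
  let D : G →+ ℚ ×ₗ G := lexHom ψ (AddMonoidHom.id G)
  have hDinj : Function.Injective D := lexHom_injective ψ Function.injective_id
  have hle : ∀ {h : K[G]} {x : G}, x ∈ face φ h.coeff.support → ψ x ≤ ψ (top (lexHom φ D) h) := by
    intro h x hx
    rcases lexHom_le_iff.1 (le_top_lexHom (D := D) hx) with h | h
    · exact h.le
    · exact h.1.le
  have hm := top_lexHom_mem_face φ D hfg
  have key : ∀ {Γ : Type _} [AddCommGroup Γ] [LinearOrder Γ] [IsOrderedAddMonoid Γ] (E : G →+ Γ),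
      Function.Injective E → ψ (top (lexHom φ E) f) = ψ (top (lexHom φ D) f) := by
    intro Γ _ _ _ E hE
    have h1 := hconst _ hm _ (top_lexHom_mem_face φ E hfg)
    rw [top_mul _ (lexHom_injective φ hE) hf hg, top_mul _ (lexHom_injective φ hDinj) hf hg,
      map_add, map_add] at h1
    have h2 := hle (top_lexHom_mem_face φ E hf)
    have h3 := hle (top_lexHom_mem_face φ E hg)
    linarith
  rw [len, map_sub, hi, lo, key (AddMonoidHom.id G) Function.injective_id,
    key (-AddMonoidHom.id G) neg_injective, sub_self]

end Length

/-! ### Factoriality of `K[G]` -/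

section Factorization

variable {K G : Type*} [Field K] [AddCommGroup G] [LinearOrder G] [IsOrderedAddMonoid G]

/-- For divisors of `f`, lengths in the direction of a fixed edge are natural multiples of one `w >
0`; `κ` is the multiplier, with value `0` off the divisors. -/
theorem exists_additive_of_collinear (hG : ACCCyclicSubgroups G) {f : K[G]} (hf : f ≠ 0)
    {φ : G →+ ℚ} (hcol : Collinear (face φ f.coeff.support))
    (hnt : (face φ f.coeff.support).Nontrivial) :
    ∃ κ : K[G] → ℕ, (∀ a b, a * b ∣ f → κ (a * b) = κ a + κ b) ∧
      ∀ a, a ∣ f → 0 < len φ a → 0 < κ a := by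
  obtain ⟨w, hw, h⟩ := exists_zsmul_of_forall_functional hG (len_pos hnt).ne'
  have hex : ∀ a, ∃ n : ℕ, a ∣ f → len φ a = n • w := by
    intro a
    by_cases ha : a ∣ f
    · obtain ⟨b, rfl⟩ := ha
      have ha0 := left_ne_zero_of_mul hf
      have hb0 := right_ne_zero_of_mul hf
      obtain ⟨k, hk⟩ := h (len φ a) fun ψ hψ => functional_len_eq_zero ha0 hb0 hcol hnt hψ
      have hk0 : 0 ≤ k := by
        by_contra hlt
        have h1 := len_nonneg φ ha0
        rw [hk] at h1
        have h2 : k • w < (0 : ℤ) • w := zsmul_left_strictMono hw (not_le.1 hlt)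
        rw [zero_smul] at h2
        exact absurd h1 (not_le.2 h2)
      lift k to ℕ using hk0
      exact ⟨k, fun _ => by rw [hk, natCast_zsmul]⟩
    · exact ⟨0, fun h => absurd h ha⟩
  choose κ hκ using hex
  refine ⟨κ, fun a b hab => ?_, fun a ha hpos => ?_⟩
  · have hab0 : a * b ≠ 0 := ne_zero_of_dvd_ne_zero hf hab
    have h1 := len_mul φ (left_ne_zero_of_mul hab0) (right_ne_zero_of_mul hab0)
    rw [hκ _ hab, hκ _ ((dvd_mul_right a b).trans hab), hκ _ ((dvd_mul_left b a).trans hab),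
      ← add_smul] at h1
    exact (nsmul_left_strictMono hw).injective h1
  · by_contra h0
    rw [hκ a ha, Nat.eq_zero_of_not_pos h0, zero_smul] at hpos
    exact lt_irrefl _ hpos

/-- Sum the multipliers over the finitely many edges of `f`. A non-unit divisor has two exponents,
so it has positive length along some edge of `f`. -/
theorem exists_additive_length (hG : ACCCyclicSubgroups G) {f : K[G]} (hf : f ≠ 0) :
    ∃ μ : K[G] → ℕ, (∀ a b, a * b ∣ f → μ (a * b) = μ a + μ b) ∧
      ∀ a, a ∣ f → ¬ IsUnit a → 0 < μ a := by
  have hex : ∀ T : Finset G, ∃ κ : K[G] → ℕ, (∀ a b, a * b ∣ f → κ (a * b) = κ a + κ b) ∧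
      ∀ φ : G →+ ℚ, face φ f.coeff.support = T → Collinear T → T.Nontrivial →
        ∀ a, a ∣ f → 0 < len φ a → 0 < κ a := by
    intro T
    by_cases h : ∃ φ : G →+ ℚ, face φ f.coeff.support = T ∧ Collinear T ∧ T.Nontrivial
    · obtain ⟨φ, rfl, hcol, hnt⟩ := h
      obtain ⟨κ, h1, h2⟩ := exists_additive_of_collinear hG hf hcol hnt
      -- Several functionals may expose the same face `T`; `len_congr` makes the choice immaterial.
      refine ⟨κ, h1, fun φ' hφ' _ _ a ha hpos => h2 a ha ?_⟩
      obtain ⟨b, rfl⟩ := ha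
      rwa [← len_congr (left_ne_zero_of_mul hf) (right_ne_zero_of_mul hf) hφ']
    · exact ⟨0, fun _ _ _ => rfl, fun φ h1 h2 h3 => absurd ⟨φ, h1, h2, h3⟩ h⟩
  choose κ hκ hκ' using hex
  refine ⟨fun a => ∑ T ∈ f.coeff.support.powerset, κ T a, fun a b hab => ?_, fun a ha hu => ?_⟩
  · rw [← Finset.sum_add_distrib]
    exact Finset.sum_congr rfl fun T _ => hκ T a b hab
  · have ha0 : a ≠ 0 := ne_zero_of_dvd_ne_zero hf ha
    have hnt : a.coeff.support.Nontrivial := by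
      rw [← Finset.one_lt_card_iff_nontrivial]
      by_contra hle
      obtain ⟨g, hg⟩ := Finset.card_eq_one.1
        (le_antisymm (not_lt.1 hle) (Finset.card_pos.2 (support_nonempty ha0)))
      obtain ⟨r, hr, h⟩ := Finsupp.support_eq_singleton'.1 hg
      exact hu (isUnit_iff_exists_single.2 ⟨g, r, hr, coeff_injective h⟩)
    obtain ⟨φ, hφ, hcol⟩ := exists_collinear_face a.coeff.support f.coeff.support hnt
    have hlen := len_pos hφ
    refine Finset.sum_pos_iff.2
      ⟨face φ f.coeff.support, Finset.mem_powerset.2 (face_subset _ _), ?_⟩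
    refine hκ' _ φ rfl hcol ?_ a ha hlen
    obtain ⟨b, rfl⟩ := ha
    have hb0 := right_ne_zero_of_mul hf
    refine ⟨hi φ (a * b), top_lexHom_mem_face φ _ hf, lo φ (a * b), top_lexHom_mem_face φ _ hf, ?_⟩
    have : 0 < len φ (a * b) := by
      rw [len_mul φ ha0 hb0]
      exact add_pos_of_pos_of_nonneg hlen (len_nonneg φ hb0)
    exact (sub_pos.1 this).ne'

/-- The group algebra of a linearly ordered group with the ascending chain condition on cyclic
subgroups over a field is factorial. -/
theorem uniqueFactorizationMonoid_of_accCyclicSubgroups (K : Type*) [Field K] {G : Type*}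
    [AddCommGroup G] [LinearOrder G] [IsOrderedAddMonoid G] (hG : ACCCyclicSubgroups G) :
    UniqueFactorizationMonoid K[G] := by
  refine UniqueFactorizationMonoid.of_exists_prime_factors fun f hf => ?_
  obtain ⟨μ, hμ, hpos⟩ := exists_additive_length hG hf
  suffices h : ∀ n, ∀ a, a ∣ f → μ a = n →
      ∃ F : Multiset K[G], (∀ b ∈ F, Prime b) ∧ Associated F.prod a from h _ f dvd_rfl rfl
  intro n
  induction n using Nat.strong_induction_on with
  | _ n ih =>
    intro a ha hn
    by_cases hu : IsUnit a
    · exact ⟨0, by simp, by simpa using (associated_one_iff_isUnit.2 hu).symm⟩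
    by_cases hirr : Irreducible a
    · exact ⟨{a}, by simpa using prime_of_irreducible hirr, by simp⟩
    rw [irreducible_iff] at hirr
    push Not at hirr
    obtain ⟨b, c, rfl, hb, hc⟩ := hirr hu
    have hbf := (dvd_mul_right b c).trans ha
    have hcf := (dvd_mul_left c b).trans ha
    have h1 := hμ b c ha
    have h2 := hpos b hbf hb
    have h3 := hpos c hcf hc
    obtain ⟨F, hF, hF'⟩ := ih (μ b) (by omega) b hbf rfl
    obtain ⟨F', hF1, hF1'⟩ := ih (μ c) (by omega) c hcf rfl
    refine ⟨F + F', fun x hx => ?_, by rw [Multiset.prod_add]; exact hF'.mul_mul hF1'⟩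
    rcases Multiset.mem_add.1 hx with h | h
    · exact hF x h
    · exact hF1 x h

end Factorization

/-! ### A Gauss lemma at a prime of `D` -/

section Gauss

variable {D : Type*} [CommRing D]
  {G : Type*} [AddCommGroup G] [LinearOrder G] [IsOrderedAddMonoid G]

/-- If a polynomial with some coefficient outside `P` multiplies `c` into `D[G]`, then the
coefficients of `c` lie in the localization at `P`. -/
theorem coeff_mem_range_algebraMap {K : Type*} [Field K] [Algebra D K] (P : Ideal D) [P.IsPrime]
    (A : Type*) [CommRing A] [Algebra D A] [IsLocalization.AtPrime A P] [Algebra A K]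
    [IsScalarTower D A K] {s e : D[G]} (hs : s ∉ coeffIdeal G P) {c : K[G]}
    (h : mapRingHom G (algebraMap D K) s * c = mapRingHom G (algebraMap D K) e) (g : G) :
    c.coeff g ∈ (algebraMap A K).range := by
  classical
  have hA := IsLocalization.AtPrime.isLocalRing A P
  let N : Submodule A K := Submodule.span A (c.coeff.support.image c.coeff : Finset K)
  let N0 : Submodule A K := LinearMap.range (Algebra.linearMap A K)
  -- By Nakayama, `N ≤ W` gives `N ≤ N0`. If `N ≤ W` fails, take the largest exponents `g0` of `c`
  -- with coefficient outside `W` and `t0` of `s` with coefficient outside `P`. In the coefficient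
  -- of the product at `t0 + g0`, every other term lies in `W`.
  let W : Submodule A K := N0 ⊔ IsLocalRing.maximalIdeal A • N
  have hcN : ∀ b, c.coeff b ∈ N := by
    intro b
    by_cases hb : c.coeff b = 0
    · rw [hb]; exact N.zero_mem
    · exact Submodule.subset_span (by
        simp only [Finset.coe_image, Set.mem_image, Finset.mem_coe, Finsupp.mem_support_iff]
        exact ⟨b, hb, rfl⟩)
  suffices hW : ∀ b, c.coeff b ∈ W by
    have hle : N ≤ N0 := by
      refine Submodule.le_of_le_smul_of_le_jacobson_bot (I := IsLocalRing.maximalIdeal A)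
        ⟨_, rfl⟩ (IsLocalRing.maximalIdeal_le_jacobson ⊥) ?_
      refine Submodule.span_le.2 ?_
      intro x hx
      simp only [Finset.coe_image, Set.mem_image] at hx
      obtain ⟨b, -, rfl⟩ := hx
      exact hW b
    obtain ⟨a, ha⟩ := hle (hcN g)
    exact ⟨a, ha⟩
  by_contra hcon
  have hsmul : ∀ (d : D) (x : K), algebraMap D K d * x = algebraMap D A d • x := fun d x => by
    rw [Algebra.smul_def, ← IsScalarTower.algebraMap_apply]
  obtain ⟨g0, hg0, hgmax⟩ : ∃ g0, c.coeff g0 ∉ W ∧ ∀ b, c.coeff b ∉ W → b ≤ g0 := by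
    push Not at hcon
    obtain ⟨b, hb⟩ := hcon
    have hsupp : ∀ b, c.coeff b ∉ W → b ∈ c.coeff.support := fun b hb =>
      Finsupp.mem_support_iff.2 fun h0 => hb (h0 ▸ W.zero_mem)
    obtain ⟨g0, hg0, hmax⟩ := (c.coeff.support.filter fun b => c.coeff b ∉ W).exists_max_image id
      ⟨b, Finset.mem_filter.2 ⟨hsupp b hb, hb⟩⟩
    exact ⟨g0, (Finset.mem_filter.1 hg0).2, fun b hb =>
      hmax b (Finset.mem_filter.2 ⟨hsupp b hb, hb⟩)⟩
  obtain ⟨t0, ht0, htmax⟩ : ∃ t0, s.coeff t0 ∉ P ∧ ∀ b, s.coeff b ∉ P → b ≤ t0 := by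
    have hs' : ∃ b, s.coeff b ∉ P := by
      by_contra! hall
      exact hs hall
    obtain ⟨b, hb⟩ := hs'
    have hsupp : ∀ b, s.coeff b ∉ P → b ∈ s.coeff.support := fun b hb =>
      Finsupp.mem_support_iff.2 fun h0 => hb (h0 ▸ P.zero_mem)
    obtain ⟨g0, hg0, hmax⟩ := (s.coeff.support.filter fun b => s.coeff b ∉ P).exists_max_image id
      ⟨b, Finset.mem_filter.2 ⟨hsupp b hb, hb⟩⟩
    exact ⟨g0, (Finset.mem_filter.1 hg0).2, fun b hb =>
      hmax b (Finset.mem_filter.2 ⟨hsupp b hb, hb⟩)⟩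
  have hN0 : ∀ d : D, algebraMap D K d ∈ W := fun d =>
    (le_sup_left : N0 ≤ W) ⟨algebraMap D A d, (IsScalarTower.algebraMap_apply D A K d).symm⟩
  have hmain : ∑ p ∈ s.coeff.support ×ˢ c.coeff.support, (if p.1 + p.2 = t0 + g0 then
      algebraMap D K (s.coeff p.1) * c.coeff p.2 else 0) ∈ W := by
    have h1 := congrArg (fun x => x.coeff (t0 + g0)) h
    simp only [coeff_mapRingHom] at h1
    have hz := hN0 (e.coeff (t0 + g0))
    rw [← h1, coeff_mul, Finsupp.sum_of_support_subset _
      (s := s.coeff.support) ?_ _ (by simp)] at hz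
    · rw [Finset.sum_product]
      simpa only [coeff_mapRingHom, Finsupp.sum] using hz
    · intro a ha
      rw [Finsupp.mem_support_iff] at ha ⊢
      rintro h0
      rw [coeff_mapRingHom, h0, map_zero] at ha
      exact ha rfl
  have hmem : (t0, g0) ∈ s.coeff.support ×ˢ c.coeff.support := by
    refine Finset.mem_product.2 ⟨Finsupp.mem_support_iff.2 fun h0 => ht0 ?_,
      Finsupp.mem_support_iff.2 fun h0 => hg0 ?_⟩
    · rw [h0]; exact P.zero_mem
    · rw [h0]; exact W.zero_mem
  rw [← Finset.add_sum_erase _ _ hmem, Submodule.add_mem_iff_left, if_pos rfl, hsmul] at hmain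
  · have hu : IsUnit (algebraMap D A (s.coeff t0)) :=
      IsLocalization.map_units A (⟨s.coeff t0, ht0⟩ : P.primeCompl)
    exact hg0 ((Submodule.smul_mem_iff_of_isUnit W hu).1 hmain)
  · refine Submodule.sum_mem _ ?_
    rintro ⟨a, b⟩ hab
    have hne := (Finset.mem_erase.1 hab).1
    split_ifs with heq
    · simp only at heq
      rw [hsmul]
      by_cases haP : s.coeff a ∈ P
      · refine (le_sup_right : _ ≤ W) (Submodule.smul_mem_smul ?_ (hcN b))
        exact (IsLocalization.AtPrime.to_map_mem_maximal_iff A P _).2 haP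
      · refine W.smul_mem _ ?_
        by_contra hbW
        have h1 := htmax a haP
        have h2 := hgmax b hbW
        have h3 : a = t0 := by
          by_contra hne'
          exact absurd heq (add_lt_add_of_lt_of_le (lt_of_le_of_ne h1 hne') h2).ne
        subst h3
        exact hne (by rw [add_left_cancel heq])
    · exact W.zero_mem

theorem exists_mul_coeff_eq [IsDomain D] {K : Type*} [Field K] [Algebra D K] [IsFractionRing D K] (P : Ideal D)
    [P.IsPrime] {s e : D[G]} (hs : s ∉ coeffIdeal G P) {c : K[G]}
    (h : mapRingHom G (algebraMap D K) s * c = mapRingHom G (algebraMap D K) e) (g : G) :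
    ∃ t, t ∉ P ∧ ∃ d, algebraMap D K t * c.coeff g = algebraMap D K d := by
  let A := Localization.subalgebra.ofField K P.primeCompl P.primeCompl_le_nonZeroDivisors
  obtain ⟨a, ha⟩ := coeff_mem_range_algebraMap P A hs h g
  obtain ⟨⟨d, t⟩, hdt⟩ := IsLocalization.surj P.primeCompl a
  refine ⟨t, t.2, d, ?_⟩
  rw [← ha, IsScalarTower.algebraMap_apply D A K, IsScalarTower.algebraMap_apply D A K, ← hdt,
    map_mul, mul_comm]

end Gauss

/-! ### Height-one primes of `D[G]` and the UMT property -/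

section GroupAlgebra

variable {D : Type*} [CommRing D] {G : Type*} [AddCommGroup G]

/-- The non-zero constants of `D[G]`. -/
noncomputable def constants (D G : Type*) [CommRing D] [AddCommGroup G] : Submonoid D[G] :=
  (nonZeroDivisors D).map (singleZeroRingHom : D →+* D[G])

theorem isLocalization_mapRingHom (D G : Type*) [CommRing D] [IsDomain D] [AddCommGroup G] :
    letI := (mapRingHom G (algebraMap D (FractionRing D))).toAlgebra
    IsLocalization (constants D G) (FractionRing D)[G] := by
  let := (mapRingHom G (algebraMap D (FractionRing D))).toAlgebra
  have hinj : Function.Injective (mapRingHom G (algebraMap D (FractionRing D))) :=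
    map_injective (algebraMap D (FractionRing D)).toAddMonoidHom
      (IsFractionRing.injective D (FractionRing D))
  refine ⟨?_, ?_, ?_⟩
  · rintro ⟨_, d, hd, rfl⟩
    have hd0 : d ≠ 0 := nonZeroDivisors.ne_zero hd
    change IsUnit (mapRingHom G (algebraMap D (FractionRing D)) (single 0 d))
    rw [mapRingHom_single]
    exact isUnit_single _ (isUnit_iff_ne_zero.2 (by simpa using hd0))
  · intro z
    suffices h : ∃ d ∈ nonZeroDivisors D, ∃ x : D[G],
        z * mapRingHom G (algebraMap D (FractionRing D)) (single 0 d) =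
          mapRingHom G (algebraMap D (FractionRing D)) x by
      obtain ⟨d, hd, x, h⟩ := h
      exact ⟨⟨x, ⟨single 0 d, d, hd, rfl⟩⟩, h⟩
    induction z using AddMonoidAlgebra.induction_linear with
    | zero => exact ⟨1, one_mem _, 0, by simp⟩
    | add f g hf hg =>
      obtain ⟨a, ha, x, hx⟩ := hf
      obtain ⟨b, hb, y, hy⟩ := hg
      refine ⟨a * b, mul_mem ha hb, x * single 0 b + y * single 0 a, ?_⟩
      have hab : (single 0 (a * b) : D[G]) = single 0 a * single 0 b := by
        rw [single_mul_single, add_zero]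
      rw [map_add, map_mul, map_mul, ← hx, ← hy, hab, map_mul]
      ring
    | single g r =>
      obtain ⟨a, b, hb, rfl⟩ := IsFractionRing.div_surjective D r
      have hb0 : algebraMap D (FractionRing D) b ≠ 0 := by
        simpa using nonZeroDivisors.ne_zero hb
      refine ⟨b, hb, single g a, ?_⟩
      rw [mapRingHom_single, mapRingHom_single, single_mul_single, add_zero,
        div_mul_cancel₀ _ hb0]
  · intro x y h
    exact ⟨1, by rw [hinj h]⟩

theorem coeffIdeal_eq_ker (P : Ideal D) :
    coeffIdeal G P = RingHom.ker (mapRingHom G (Ideal.Quotient.mk P)) := by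
  ext f
  rw [RingHom.mem_ker, ← coeff_inj, Finsupp.ext_iff]
  refine forall_congr' fun g => ?_
  rw [coeff_mapRingHom, coeff_zero, Finsupp.zero_apply, Ideal.Quotient.eq_zero_iff_mem]

theorem single_mem_coeffIdeal {P : Ideal D} {d : D} :
    (single 0 d : D[G]) ∈ coeffIdeal G P ↔ d ∈ P := by
  constructor
  · intro h
    simpa using h 0
  · intro h g
    classical
    rw [coeff_single, Finsupp.single_apply]
    split_ifs
    · exact h
    · exact P.zero_mem

theorem coeffIdeal_le {P : Ideal D} {Q : Ideal D[G]} (h : ∀ d ∈ P, (single 0 d : D[G]) ∈ Q) :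
    coeffIdeal G P ≤ Q := by
  intro f hf
  rw [← sum_coeff_single f]
  refine Ideal.sum_mem _ fun g _ => ?_
  have : (single g (f.coeff g) : D[G]) = single g 1 * single 0 (f.coeff g) := by
    rw [single_mul_single, add_zero, one_mul]
  rw [this]
  exact Q.mul_mem_left _ (h _ (hf g))

theorem coeffIdeal_ne_bot {P : Ideal D} (h : P ≠ ⊥) : coeffIdeal G P ≠ ⊥ := by
  obtain ⟨d, hd, hd0⟩ := Submodule.exists_mem_ne_zero_of_ne_bot h
  intro hbot
  have := (single_mem_coeffIdeal (G := G)).2 hd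
  rw [hbot, Ideal.mem_bot, single_eq_zero] at this
  exact hd0 this

theorem coeffIdeal_injective : Function.Injective (coeffIdeal (D := D) G) := fun P P' h => by
  ext d
  rw [← single_mem_coeffIdeal (G := G), h, single_mem_coeffIdeal]

theorem single_dvd_single_iff {a b : D} :
    (single 0 a : D[G]) ∣ single 0 b ↔ a ∣ b := by
  constructor
  · rintro ⟨f, hf⟩
    refine ⟨f.coeff 0, ?_⟩
    have := congrArg (fun x => x.coeff 0) hf
    rwa [coeff_single_zero_mul, coeff_single, Finsupp.single_eq_same] at this
  · rintro ⟨c, rfl⟩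
    exact ⟨single 0 c, by rw [single_mul_single, add_zero]⟩

theorem coeffIdeal_isPrime [LinearOrder G] [IsOrderedAddMonoid G] (P : Ideal D) [P.IsPrime] : (coeffIdeal G P).IsPrime := by
  rw [coeffIdeal_eq_ker]
  exact RingHom.ker_isPrime _

variable [IsDomain D]

theorem exists_eq_comap_mapRingHom {Q : PrimeSpectrum D[G]} (hQ : Q ∈ heightOnePrimes D[G])
    (h : ∀ d : D, d ≠ 0 → (single 0 d : D[G]) ∉ Q.asIdeal) :
    ∃ Q' ∈ heightOnePrimes (FractionRing D)[G],
      Q.asIdeal = Q'.asIdeal.comap (mapRingHom G (algebraMap D (FractionRing D))) := by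
  let := (mapRingHom G (algebraMap D (FractionRing D))).toAlgebra
  have := isLocalization_mapRingHom D G
  obtain ⟨Q', hQ', he⟩ := exists_comap_eq_of_disjoint (B := (FractionRing D)[G]) (constants D G) hQ
    (by
      rw [Set.disjoint_left]
      rintro _ ⟨d, hd, rfl⟩
      exact h d (nonZeroDivisors.ne_zero hd))
  exact ⟨Q', hQ', he.symm⟩

theorem comap_mapRingHom_mem_heightOnePrimes {Q : PrimeSpectrum (FractionRing D)[G]}
    (hQ : Q ∈ heightOnePrimes (FractionRing D)[G]) :
    PrimeSpectrum.comap (mapRingHom G (algebraMap D (FractionRing D))) Q ∈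
      heightOnePrimes D[G] := by
  let := (mapRingHom G (algebraMap D (FractionRing D))).toAlgebra
  have := isLocalization_mapRingHom D G
  exact comap_mem_heightOnePrimes (constants D G) hQ

variable [LinearOrder G] [IsOrderedAddMonoid G]

/-- A height-one prime of `D[G]` meeting `D` is extended from a height-one prime of `D`. -/
theorem exists_eq_coeffIdeal {Q : PrimeSpectrum D[G]} (hQ : Q ∈ heightOnePrimes D[G]) {d : D}
    (hd : d ≠ 0) (hdQ : (single 0 d : D[G]) ∈ Q.asIdeal) :
    ∃ P ∈ heightOnePrimes D, Q.asIdeal = coeffIdeal G P.asIdeal := by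
  let P : PrimeSpectrum D := PrimeSpectrum.comap (singleZeroRingHom : D →+* D[G]) Q
  have hmem : ∀ x, x ∈ P.asIdeal ↔ (single 0 x : D[G]) ∈ Q.asIdeal := fun _ => Iff.rfl
  have hext : ∀ P' : Ideal D, P'.IsPrime → P' ≠ ⊥ → P' ≤ P.asIdeal →
      coeffIdeal G P' = Q.asIdeal := by
    intro P' hP' h0 hle
    have := coeffIdeal_isPrime (G := G) P'
    exact eq_of_le_of_height_eq_one hQ (coeffIdeal_ne_bot h0) (coeffIdeal_le fun x hx => hle hx)
  have hP0 : P.asIdeal ≠ ⊥ := fun h => hd (by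
    have := (hmem d).2 hdQ
    rwa [h] at this)
  refine ⟨P, ?_, (hext _ P.2 hP0 le_rfl).symm⟩
  exact height_eq_one_of_forall hP0 fun P' hP' h0 hle =>
    coeffIdeal_injective (G := G) ((hext P' hP' h0 hle).trans (hext _ P.2 hP0 le_rfl).symm)

/-- `D` is `G`-UMT if and only if all height-one primes of `D` extend to height-one primes. -/
theorem isUMT_iff : IsUMT D G ↔
    ∀ P ∈ heightOnePrimes D, (coeffIdeal G P.asIdeal).height = 1 := by
  constructor
  · intro h P hP
    have : coeffIdeal G P.asIdeal ∈ PrimeSpectrum.asIdeal '' heightOnePrimes D[G] := by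
      rw [h]
      exact Or.inl ⟨P, hP, rfl⟩
    obtain ⟨Q, hQ, he⟩ := this
    rw [← he]
    exact hQ
  · intro h
    refine Set.Subset.antisymm ?_ ?_
    · rintro _ ⟨Q, hQ, rfl⟩
      by_cases hex : ∃ d : D, d ≠ 0 ∧ (single 0 d : D[G]) ∈ Q.asIdeal
      · obtain ⟨d, hd, hdQ⟩ := hex
        exact Or.inl (exists_eq_coeffIdeal hQ hd hdQ)
      · push Not at hex
        exact Or.inr (exists_eq_comap_mapRingHom hQ hex)
    · rintro I (⟨P, hP, rfl⟩ | ⟨Q, hQ, rfl⟩)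
      · exact ⟨⟨_, coeffIdeal_isPrime P.asIdeal⟩, h P hP, rfl⟩
      · exact ⟨_, comap_mapRingHom_mem_heightOnePrimes hQ, rfl⟩

end GroupAlgebra

/-! ### When `D[G]` is weakly Krull -/

section GroupAlgebraCharacterization

variable {D : Type*} [CommRing D] [IsDomain D]
  {G : Type*} [AddCommGroup G] [LinearOrder G] [IsOrderedAddMonoid G]

/-- If `P[G]` had height other than one, prime avoidance would give `b` in `P` outside the finitely
many height-one primes containing a chosen `a ≠ 0` of `P`. From `a ∣ c * b ^ n` with `c ∉ P` one
gets `a ∣ c` locally at each height-one prime, hence globally, so `c ∈ P`. -/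
theorem isUMT_of_isWeaklyKrullDomain (h : IsWeaklyKrullDomain D[G]) : IsUMT D G := by
  obtain ⟨h1, h2⟩ := isWeaklyKrullDomain_iff.1 h
  rw [isUMT_iff]
  intro P hP
  by_contra hht
  obtain ⟨a, haP, ha0⟩ := Submodule.exists_mem_ne_zero_of_ne_bot
    (P.asIdeal.ne_bot_of_height_eq_one hP)
  have haunit : ¬ IsUnit (single 0 a : D[G]) := by
    intro hu
    have := single_mem_coeffIdeal (G := G) (P := P.asIdeal).2 haP
    exact (coeffIdeal_isPrime (G := G) P.asIdeal).ne_top (Ideal.eq_top_of_isUnit_mem _ this hu)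
  have hfin := h2 (single 0 a) (by rwa [Ne, single_eq_zero]) haunit
  let C : D →+* D[G] := singleZeroRingHom
  have hb : ∃ b ∈ P.asIdeal, ∀ Q ∈ heightOnePrimes D[G], (single 0 a : D[G]) ∈ Q.asIdeal →
      (single 0 b : D[G]) ∉ Q.asIdeal := by
    by_contra! hcon
    have hsub : (P.asIdeal : Set D) ⊆
        ⋃ Q ∈ {Q ∈ heightOnePrimes D[G] | (single 0 a : D[G]) ∈ Q.asIdeal},
          (Q.asIdeal.comap C : Set D) := by
      intro b hb
      obtain ⟨Q, hQ, haQ, hbQ⟩ := hcon b hb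
      exact Set.mem_biUnion (x := Q) ⟨hQ, haQ⟩ hbQ
    -- Prime avoidance exempts two indices from primality; `⊥` fills both slots, since all the
    -- ideals here are prime.
    obtain ⟨Q, ⟨hQ, haQ⟩, hle⟩ := (Ideal.subset_union_prime_finite hfin
      (f := fun Q => Q.asIdeal.comap C) ⟨⊥, Ideal.isPrime_bot⟩ ⟨⊥, Ideal.isPrime_bot⟩ fun Q _ _ _ => Ideal.IsPrime.comap C).1 hsub
    obtain ⟨P', hP', he⟩ := exists_eq_coeffIdeal hQ ha0 haQ
    have hle' : P.asIdeal ≤ P'.asIdeal := by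
      intro x hx
      have : (single 0 x : D[G]) ∈ Q.asIdeal := hle hx
      rwa [he, single_mem_coeffIdeal] at this
    rw [eq_of_le_of_height_eq_one hP' (P.asIdeal.ne_bot_of_height_eq_one hP) hle', ← he] at hht
    exact hht hQ
  obtain ⟨b, hbP, hb⟩ := hb
  obtain ⟨n, c, hc, hdvd⟩ := exists_dvd_mul_pow_of_height_eq_one hP ha0 hbP
  have hac : (single 0 a : D[G]) ∣ single 0 c := by
    refine h1 _ _ (by rwa [Ne, single_eq_zero]) fun Q hQ => ?_
    by_cases haQ : (single 0 a : D[G]) ∈ Q.asIdeal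
    · refine ⟨single 0 (b ^ n), fun hmem => hb Q hQ haQ ?_, ?_⟩
      · refine Q.2.mem_of_pow_mem n ?_
        rwa [single_pow, smul_zero]
      · rw [single_mul_single, add_zero, single_dvd_single_iff, mul_comm]
        exact hdvd
    · exact ⟨_, haQ, dvd_mul_right _ _⟩
  exact hc (P.asIdeal.mem_of_dvd (single_dvd_single_iff.1 hac) haP)

theorem isWeaklyKrullDomain_of_groupAlgebra (h : IsWeaklyKrullDomain D[G]) :
    IsWeaklyKrullDomain D := by
  have humt := isUMT_iff.1 (isUMT_of_isWeaklyKrullDomain h)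
  obtain ⟨h1, h2⟩ := isWeaklyKrullDomain_iff.1 h
  rw [isWeaklyKrullDomain_iff]
  constructor
  · intro x y hy hxy
    refine single_dvd_single_iff.1 (h1 (single 0 x) (single 0 y) (by rwa [Ne, single_eq_zero])
      fun Q hQ => ?_)
    by_cases hex : ∃ d : D, d ≠ 0 ∧ (single 0 d : D[G]) ∈ Q.asIdeal
    · obtain ⟨d, hd, hdQ⟩ := hex
      obtain ⟨P, hP, he⟩ := exists_eq_coeffIdeal hQ hd hdQ
      obtain ⟨s, hs, hdvd⟩ := hxy P hP
      refine ⟨single 0 s, by rwa [he, single_mem_coeffIdeal], ?_⟩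
      rwa [single_mul_single, add_zero, single_dvd_single_iff]
    · push Not at hex
      exact ⟨single 0 y, hex y hy, dvd_mul_right _ _⟩
  · intro a ha hu
    have hfin := h2 (single 0 a) (by rwa [Ne, single_eq_zero]) fun h => hu (isUnit_iff_dvd_one.2
      (single_dvd_single_iff.1 (isUnit_iff_dvd_one.1 h)))
    refine Set.Finite.of_injOn (f := fun P => (⟨_, coeffIdeal_isPrime P.asIdeal⟩ :
      PrimeSpectrum D[G])) ?_ ?_ hfin
    · exact fun P hP => ⟨humt P hP.1, single_mem_coeffIdeal.2 hP.2⟩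
    intro P _ P' _ he
    exact PrimeSpectrum.ext (coeffIdeal_injective (G := G) (congrArg PrimeSpectrum.asIdeal he))

/-- A quotient `c` exists in `K[G]`, and the Gauss lemma puts its coefficients into every
localization of `D` at a height-one prime, hence into `D`. For finiteness, `P[G]` containing `a`
forces `P` to contain one fixed non-zero coefficient of `a`. -/
theorem isWeaklyKrullDomain_groupAlgebra (hK : IsWeaklyKrullDomain (FractionRing D)[G])
    (hD : IsWeaklyKrullDomain D) (humt : IsUMT D G) : IsWeaklyKrullDomain D[G] := by
  obtain ⟨hK1, hK2⟩ := isWeaklyKrullDomain_iff.1 hK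
  obtain ⟨hD1, hD2⟩ := isWeaklyKrullDomain_iff.1 hD
  rw [isUMT_iff] at humt
  let ι := mapRingHom G (algebraMap D (FractionRing D))
  have hι : Function.Injective ι :=
    map_injective (algebraMap D (FractionRing D)).toAddMonoidHom
      (IsFractionRing.injective D (FractionRing D))
  rw [isWeaklyKrullDomain_iff]
  constructor
  · intro a b hb h
    have hb' : ι b ≠ 0 := fun h0 => hb (hι (h0.trans (map_zero ι).symm))
    obtain ⟨c, hc⟩ : ι b ∣ ι a := by
      refine hK1 _ _ hb' fun Q hQ => ?_
      obtain ⟨s, hs, hdvd⟩ := h _ (comap_mapRingHom_mem_heightOnePrimes hQ)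
      exact ⟨ι s, hs, by rw [← map_mul]; exact map_dvd ι hdvd⟩
    have hcoeff : ∀ g, ∃ d, algebraMap D (FractionRing D) d = c.coeff g := by
      intro g
      obtain ⟨x, y, hy, hxy⟩ := IsFractionRing.div_surjective D (c.coeff g)
      have hy0 : y ≠ 0 := nonZeroDivisors.ne_zero hy
      have hy' : algebraMap D (FractionRing D) y ≠ 0 := by simpa using hy0
      obtain ⟨d, rfl⟩ : y ∣ x := by
        refine hD1 x y hy0 fun P hP => ?_
        obtain ⟨s, hs, e, he⟩ := h ⟨_, coeffIdeal_isPrime P.asIdeal⟩ (humt P hP)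
        have hse : ι s * c = ι e := by
          apply mul_left_cancel₀ hb'
          rw [mul_left_comm, ← hc, ← map_mul, ← map_mul, he]
        obtain ⟨t, ht, d, htd⟩ := exists_mul_coeff_eq P.asIdeal hs hse g
        refine ⟨t, ht, d, IsFractionRing.injective D (FractionRing D) ?_⟩
        rw [← hxy] at htd
        field_simp at htd
        rw [map_mul, map_mul, htd]
      refine ⟨d, ?_⟩
      rw [← hxy, map_mul]
      field_simp
    obtain ⟨e, he⟩ : c ∈ Set.range (AddMonoidAlgebra.map (M := G)
        (algebraMap D (FractionRing D)).toAddMonoidHom) := by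
      rw [range_map]
      exact hcoeff
    refine ⟨e, hι ?_⟩
    rw [map_mul, hc, ← he]
    rfl
  · intro a ha hu
    have ha' : ι a ≠ 0 := fun h0 => ha (hι (h0.trans (map_zero ι).symm))
    obtain ⟨g, hg⟩ := support_nonempty ha
    rw [Finsupp.mem_support_iff] at hg
    have hfin1 : {P ∈ heightOnePrimes D | a.coeff g ∈ P.asIdeal}.Finite := by
      by_cases hgu : IsUnit (a.coeff g)
      · refine Set.finite_empty.subset fun P hP => ?_
        exact P.2.ne_top (Ideal.eq_top_of_isUnit_mem _ hP.2 hgu)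
      · exact hD2 _ hg hgu
    have hfin2 : {Q ∈ heightOnePrimes (FractionRing D)[G] | ι a ∈ Q.asIdeal}.Finite := by
      by_cases hgu : IsUnit (ι a)
      · refine Set.finite_empty.subset fun P hP => ?_
        exact P.2.ne_top (Ideal.eq_top_of_isUnit_mem _ hP.2 hgu)
      · exact hK2 _ ha' hgu
    refine ((hfin1.image fun P => (⟨_, coeffIdeal_isPrime P.asIdeal⟩ :
      PrimeSpectrum D[G])).union (hfin2.image (PrimeSpectrum.comap ι))).subset ?_
    rintro Q ⟨hQ, haQ⟩
    by_cases hex : ∃ d : D, d ≠ 0 ∧ (single 0 d : D[G]) ∈ Q.asIdeal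
    · obtain ⟨d, hd, hdQ⟩ := hex
      obtain ⟨P, hP, he⟩ := exists_eq_coeffIdeal hQ hd hdQ
      exact Or.inl ⟨P, ⟨hP, (he ▸ haQ : a ∈ coeffIdeal G P.asIdeal) g⟩, PrimeSpectrum.ext he.symm⟩
    · push Not at hex
      obtain ⟨Q', hQ', he⟩ := exists_eq_comap_mapRingHom hQ hex
      refine Or.inr ⟨Q', ⟨hQ', ?_⟩, PrimeSpectrum.ext he.symm⟩
      rw [he] at haQ
      exact haQ

theorem isWeaklyKrullDomain_groupAlgebra_iff (hG : ACCCyclicSubgroups G) :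
    IsWeaklyKrullDomain D[G] ↔ IsWeaklyKrullDomain D ∧ IsUMT D G := by
  have := uniqueFactorizationMonoid_of_accCyclicSubgroups (FractionRing D) hG
  exact ⟨fun h => ⟨isWeaklyKrullDomain_of_groupAlgebra h, isUMT_of_isWeaklyKrullDomain h⟩,
    fun h => isWeaklyKrullDomain_groupAlgebra
      (isWeaklyKrullDomain_of_uniqueFactorizationMonoid _) h.1 h.2⟩

end GroupAlgebraCharacterization

/-! ### The non-negative monoid is weakly Krull exactly in the Archimedean case -/

section NonnegMonoid

variable {G : Type*} [AddCommGroup G] [LinearOrder G] [IsOrderedAddMonoid G]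

theorem nonneg_add_eq_zero {a b : AddSubmonoid.nonneg G} (h : a + b = 0) : a = 0 ∧ b = 0 := by
  have ha : (0 : G) ≤ a := a.2
  have hb : (0 : G) ≤ b := b.2
  have h' : (a : G) + b = 0 := congrArg Subtype.val h
  exact ⟨Subtype.ext ((add_eq_zero_iff_of_nonneg ha hb).1 h').1,
    Subtype.ext ((add_eq_zero_iff_of_nonneg ha hb).1 h').2⟩

theorem exists_eq_add_of_le {a b : AddSubmonoid.nonneg G} (h : (a : G) ≤ b) :
    ∃ c : AddSubmonoid.nonneg G, b = a + c :=
  ⟨⟨b - a, sub_nonneg.2 h⟩, Subtype.ext (add_sub_cancel (a : G) b).symm⟩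

theorem coe_pos_of_ne_zero {a : AddSubmonoid.nonneg G} (h : a ≠ 0) : (0 : G) < a :=
  lt_of_le_of_ne a.2 fun h0 => h (Subtype.ext h0.symm)

theorem exists_le_nsmul [Archimedean G] (a : AddSubmonoid.nonneg G) {b : AddSubmonoid.nonneg G}
    (hb : b ≠ 0) : ∃ (n : ℕ) (c : AddSubmonoid.nonneg G), n • b = a + c := by
  obtain ⟨n, hn⟩ := Archimedean.arch (a : G) (coe_pos_of_ne_zero hb)
  obtain ⟨c, hc⟩ := exists_eq_add_of_le (a := a) (b := n • b) hn
  exact ⟨n, c, hc⟩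

/-- The ideal of non-zero elements of the non-negative monoid. -/
def nonzeroIdeal (G : Type*) [AddCommGroup G] [LinearOrder G] [IsOrderedAddMonoid G] :
    AddSemigroupIdeal (AddSubmonoid.nonneg G) where
  carrier := {a | a ≠ 0}
  vadd_mem' _ _ ha h := ha (nonneg_add_eq_zero h).2

theorem mem_nonzeroIdeal {a : AddSubmonoid.nonneg G} : a ∈ nonzeroIdeal G ↔ a ≠ 0 := Iff.rfl

theorem isPrimeIdeal_nonzeroIdeal : IsPrimeIdeal (nonzeroIdeal G) := by
  refine ⟨fun h => h rfl, fun a b hab => ?_⟩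
  by_contra! hcon
  simp only [mem_nonzeroIdeal, not_not] at hcon
  exact hab (by rw [hcon.1, hcon.2, add_zero])

theorem IsPrimeIdeal.mem_of_nsmul_mem {S : Type*} [AddCommMonoid S] {P : AddSemigroupIdeal S}
    (hP : IsPrimeIdeal P) {a : S} {n : ℕ} (h : n • a ∈ P) : a ∈ P := by
  induction n with
  | zero => exact absurd (by rwa [zero_smul] at h) hP.1
  | succ n ih =>
    rw [succ_nsmul] at h
    exact (hP.2 _ _ h).elim ih id

theorem IsPrimeIdeal.eq_nonzeroIdeal [Archimedean G]
    {P : AddSemigroupIdeal (AddSubmonoid.nonneg G)} (hP : IsPrimeIdeal P)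
    (hne : (P : Set (AddSubmonoid.nonneg G)).Nonempty) : P = nonzeroIdeal G := by
  ext b
  rw [mem_nonzeroIdeal]
  constructor
  · rintro hb rfl
    exact hP.1 hb
  · intro hb
    obtain ⟨a, ha⟩ := hne
    obtain ⟨n, c, hn⟩ := exists_le_nsmul a hb
    refine hP.mem_of_nsmul_mem (n := n) ?_
    rw [hn, add_comm]
    exact P.add_mem c ha

theorem isWeaklyKrullMonoid_of_archimedean [Archimedean G] :
    IsWeaklyKrullMonoid (AddSubmonoid.nonneg G) := by
  have heq : ∀ P ∈ minimalPrimeIdeals (AddSubmonoid.nonneg G), P = nonzeroIdeal G :=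
    fun P hP => IsPrimeIdeal.eq_nonzeroIdeal hP.1.1 hP.1.2
  constructor
  · refine Set.Subset.antisymm (fun x hx => ?_) ?_
    -- For trivial `S` there is no minimal non-empty prime and the intersection is the quotient
    -- group, itself trivial.
    · cases subsingleton_or_nontrivial (AddSubmonoid.nonneg G) with
      | inl hsub =>
        induction x using AddLocalization.ind with
        | _ y =>
          refine ⟨y.1, ?_⟩
          have : y.2 = 0 := Subtype.ext (Subsingleton.elim _ _)
          rw [this]
          exact (AddLocalization.mk_zero_eq_addMonoidOf_mk y.1).symm
      | inr hnt =>
        obtain ⟨a, ha⟩ := exists_ne (0 : AddSubmonoid.nonneg G)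
        have hmem : nonzeroIdeal G ∈ minimalPrimeIdeals (AddSubmonoid.nonneg G) :=
          ⟨⟨isPrimeIdeal_nonzeroIdeal, a, ha⟩, fun P hP _ =>
            (hP.1.eq_nonzeroIdeal hP.2).ge⟩
        obtain ⟨b, c, hc, rfl⟩ := Set.mem_iInter₂.1 hx _ hmem
        rw [mem_nonzeroIdeal, not_not] at hc
        exact ⟨b, by rw [hc, map_zero, sub_zero]⟩
    · rintro _ ⟨a, rfl⟩
      exact Set.mem_iInter₂.2 fun P hP => ⟨a, 0, hP.1.1.1, by rw [map_zero, sub_zero]⟩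
  · exact fun a _ => (Set.finite_singleton (nonzeroIdeal G)).subset fun P hP => heq P hP.1

/-- If all multiples of `s` stay below `t`, the elements exceeding every multiple of `s` form a
non-empty prime. It lies strictly inside any prime containing `s`, so `s` is in no minimal prime;
then `-s` is in every localization and `s` would be invertible. -/
theorem archimedean_of_isWeaklyKrullMonoid (h : IsWeaklyKrullMonoid (AddSubmonoid.nonneg G)) :
    Archimedean G := by
  refine ⟨fun t s hs => ?_⟩
  by_contra! hcon
  have ht : 0 < t := by simpa using hcon 0
  let s' : AddSubmonoid.nonneg G := ⟨s, hs.le⟩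
  let I : AddSemigroupIdeal (AddSubmonoid.nonneg G) :=
    { carrier := {x | ∀ n : ℕ, n • s < (x : G)}
      vadd_mem' := fun c x hx n => (hx n).trans_le (le_add_of_nonneg_left c.2) }
  have hI : ∀ x : AddSubmonoid.nonneg G, x ∈ I ↔ ∀ n : ℕ, n • s < (x : G) := fun _ => Iff.rfl
  have hIp : IsPrimeIdeal I := by
    refine ⟨fun h0 => ?_, fun a b hab => ?_⟩
    · simpa using (hI 0).1 h0 0
    · by_contra! hnot
      simp only [hI, not_forall, not_lt] at hnot
      obtain ⟨⟨n, hn⟩, m, hm⟩ := hnot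
      have := (hI _).1 hab (n + m)
      rw [add_smul] at this
      exact absurd this (not_lt.2 (add_le_add hn hm))
  have hmem : ∀ P ∈ minimalPrimeIdeals (AddSubmonoid.nonneg G), s' ∉ P := by
    intro P hP hsP
    have hle : I ≤ P := by
      intro x hx
      have h1 : s < (x : G) := by simpa using (hI x).1 hx 1
      obtain ⟨c, rfl⟩ := exists_eq_add_of_le (a := s') (b := x) h1.le
      rw [add_comm]
      exact P.add_mem c hsP
    have hge := hP.2 ⟨hIp, ⟨t, ht.le⟩, fun n => hcon n⟩ hle
    simpa [s'] using (hI s').1 (hge hsP) 1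
  have hx : (Algebra.GrothendieckAddGroup.of 0 - Algebra.GrothendieckAddGroup.of s' :
      Algebra.GrothendieckAddGroup (AddSubmonoid.nonneg G)) ∈
      ⋂ P ∈ minimalPrimeIdeals (AddSubmonoid.nonneg G), monoidLocalization P :=
    Set.mem_iInter₂.2 fun P hP => ⟨0, s', hmem P hP, rfl⟩
  rw [h.1] at hx
  obtain ⟨x, hx⟩ := hx
  rw [eq_sub_iff_add_eq, ← map_add] at hx
  have h0 := (nonneg_add_eq_zero (Algebra.GrothendieckAddGroup.of_injective hx)).2
  exact hs.ne' (congrArg Subtype.val h0)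

theorem isWeaklyKrullMonoid_nonneg_iff :
    IsWeaklyKrullMonoid (AddSubmonoid.nonneg G) ↔ Archimedean G :=
  ⟨archimedean_of_isWeaklyKrullMonoid, fun _ => isWeaklyKrullMonoid_of_archimedean⟩

end NonnegMonoid

/-! ### Elements of `D[S]` without constant term, and the order of vanishing -/

section NonnegAlgebra

variable {D : Type*} [CommRing D] {G : Type*} [AddCommGroup G] [LinearOrder G]
  [IsOrderedAddMonoid G]

theorem coeff_mul_zero_nonneg (f g : D[AddSubmonoid.nonneg G]) :
    (f * g).coeff 0 = f.coeff 0 * g.coeff 0 := by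
  have := coeff_mul_add_of_uniqueAdd (f := f) (g := g) (a0 := 0) (b0 := 0)
    fun a b _ _ h => nonneg_add_eq_zero (h.trans (add_zero 0))
  rwa [add_zero] at this

/-- The ideal of elements of `D[S]` without constant term. -/
def positiveIdeal (D G : Type*) [CommRing D] [AddCommGroup G] [LinearOrder G]
    [IsOrderedAddMonoid G] : Ideal D[AddSubmonoid.nonneg G] where
  carrier := {f | f.coeff 0 = 0}
  zero_mem' := rfl
  add_mem' {f g} (hf : f.coeff 0 = 0) (hg : g.coeff 0 = 0) := by
    change (f + g).coeff 0 = 0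
    rw [coeff_add, Finsupp.add_apply, hf, hg, add_zero]
  smul_mem' c f (hf : f.coeff 0 = 0) := by
    change (c * f).coeff 0 = 0
    rw [coeff_mul_zero_nonneg, hf, mul_zero]

theorem mem_positiveIdeal {f : D[AddSubmonoid.nonneg G]} :
    f ∈ positiveIdeal D G ↔ f.coeff 0 = 0 := Iff.rfl

theorem single_dvd_of_forall_le {f : D[AddSubmonoid.nonneg G]} {s : AddSubmonoid.nonneg G}
    (h : ∀ t, f.coeff t ≠ 0 → (s : G) ≤ t) : single s 1 ∣ f := by
  rw [← sum_coeff_single f]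
  refine Finset.dvd_sum fun t ht => ?_
  obtain ⟨c, rfl⟩ := exists_eq_add_of_le (h t (Finsupp.mem_support_iff.1 ht))
  exact ⟨single c (f.coeff (s + c)), by rw [single_mul_single, one_mul]⟩

/-- By the Archimedean property, some power of each monomial of positive degree is a multiple of
`X^s`. -/
theorem positiveIdeal_le [Archimedean G] {P : Ideal D[AddSubmonoid.nonneg G]} (hP : P.IsPrime)
    {s : AddSubmonoid.nonneg G} (hs : single s 1 ∈ P) : positiveIdeal D G ≤ P := by
  intro f hf
  rw [← sum_coeff_single f]
  refine Ideal.sum_mem _ fun t ht => ?_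
  have ht0 : t ≠ 0 := by
    rintro rfl
    exact Finsupp.mem_support_iff.1 ht hf
  obtain ⟨n, c, hn⟩ := exists_le_nsmul s ht0
  have hpow : (single t 1 : D[AddSubmonoid.nonneg G]) ^ n ∈ P := by
    rw [single_pow, one_pow, hn, show (single (s + c) 1 : D[AddSubmonoid.nonneg G]) =
      single s 1 * single c 1 by rw [single_mul_single, one_mul]]
    exact P.mul_mem_right _ hs
  have : (single t (f.coeff t) : D[AddSubmonoid.nonneg G]) =
      single 0 (f.coeff t) * single t 1 := by
    rw [single_mul_single, zero_add, mul_one]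
  rw [this]
  exact P.mul_mem_left _ (hP.mem_of_pow_mem n hpow)

/-- The least element of the support. -/
noncomputable def ord (f : D[AddSubmonoid.nonneg G]) : AddSubmonoid.nonneg G :=
  top (-(AddSubmonoid.nonneg G).subtype) f

theorem neg_subtype_injective :
    Function.Injective (-(AddSubmonoid.nonneg G).subtype : AddSubmonoid.nonneg G →+ G) :=
  neg_injective.comp (AddSubmonoid.subtype_injective _)

theorem coeff_ord_ne_zero {f : D[AddSubmonoid.nonneg G]} (hf : f ≠ 0) : f.coeff (ord f) ≠ 0 :=
  coeff_top_ne_zero _ hf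

theorem ord_le {f : D[AddSubmonoid.nonneg G]} {s : AddSubmonoid.nonneg G} (hs : f.coeff s ≠ 0) :
    (ord f : G) ≤ s := by
  simpa [ord] using le_top (-(AddSubmonoid.nonneg G).subtype) hs

theorem ord_eq_zero {f : D[AddSubmonoid.nonneg G]} (hf : f ∉ positiveIdeal D G) : ord f = 0 := by
  have h1 : (ord f : G) ≤ 0 := ord_le hf
  exact Subtype.ext (le_antisymm h1 (ord f).2)

variable [IsDomain D]

instance positiveIdeal_isPrime : (positiveIdeal D G).IsPrime := by
  refine Ideal.isPrime_iff.2 ⟨?_, fun {f g} h => ?_⟩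
  · rw [Ne, Ideal.eq_top_iff_one, mem_positiveIdeal, coeff_one_zero]
    exact one_ne_zero
  · rw [mem_positiveIdeal, coeff_mul_zero_nonneg] at h
    exact mul_eq_zero.1 h

theorem ord_mul {f g : D[AddSubmonoid.nonneg G]} (hf : f ≠ 0) (hg : g ≠ 0) :
    ord (f * g) = ord f + ord g := top_mul _ neg_subtype_injective hf hg

theorem exists_eq_single_ord_mul {f : D[AddSubmonoid.nonneg G]} (hf : f ≠ 0) :
    ∃ g, g ∉ positiveIdeal D G ∧ f = single (ord f) 1 * g := by
  obtain ⟨g, hg⟩ := single_dvd_of_forall_le (f := f) (s := ord f) fun t ht => ord_le ht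
  refine ⟨g, fun h => ?_, hg⟩
  have h1 : g ≠ 0 := by rintro rfl; exact hf (by rw [hg, mul_zero])
  have h2 := ord_mul (single_ne_zero.2 (one_ne_zero (α := D))) h1 (f := single (ord f) 1)
  rw [← hg, show ord (single (ord f) (1 : D)) = ord f from
    top_single neg_subtype_injective _ one_ne_zero, left_eq_add] at h2
  exact coeff_ord_ne_zero h1 (h2 ▸ h)

theorem positiveIdeal_ne_bot [Nontrivial (AddSubmonoid.nonneg G)] : positiveIdeal D G ≠ ⊥ := by
  obtain ⟨s, hs⟩ := exists_ne (0 : AddSubmonoid.nonneg G)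
  intro h
  have : (single s 1 : D[AddSubmonoid.nonneg G]) ∈ positiveIdeal D G := by
    rw [mem_positiveIdeal, coeff_single, Finsupp.single_eq_of_ne hs.symm]
  rw [h, Ideal.mem_bot, single_eq_zero] at this
  exact one_ne_zero this

/-- Writing a non-zero `f` in a smaller prime as `X^(ord f) * g`, with `g` having a constant term,
puts a monomial into that prime, and then all of positive degree. -/
theorem height_positiveIdeal [Archimedean G] [Nontrivial (AddSubmonoid.nonneg G)] :
    (positiveIdeal D G).height = 1 := by
  refine height_eq_one_of_forall positiveIdeal_ne_bot fun Q hQ hQ0 hle => le_antisymm hle ?_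
  obtain ⟨f, hfQ, hf⟩ := Submodule.exists_mem_ne_zero_of_ne_bot hQ0
  obtain ⟨g, hg, he⟩ := exists_eq_single_ord_mul hf
  rw [he] at hfQ
  exact positiveIdeal_le hQ ((hQ.mem_or_mem hfQ).resolve_right fun h => hg (hle h))

theorem eq_positiveIdeal [Archimedean G] {P : Ideal D[AddSubmonoid.nonneg G]} [hP : P.IsPrime]
    (h : P.height = 1) {s : AddSubmonoid.nonneg G} (hs0 : s ≠ 0) (hs : single s 1 ∈ P) :
    P = positiveIdeal D G := by
  have : Nontrivial (AddSubmonoid.nonneg G) := ⟨s, 0, hs0⟩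
  exact (eq_of_le_of_height_eq_one h positiveIdeal_ne_bot (positiveIdeal_le hP hs)).symm

/-- If all multiples of `s` stay below `t`, then `X^s` lies in no height-one prime, so it would
divide `1`, contradicting the constant terms. -/
theorem archimedean_of_isWeaklyKrullDomain
    (h : IsWeaklyKrullDomain D[AddSubmonoid.nonneg G]) : Archimedean G := by
  obtain ⟨h1, -⟩ := isWeaklyKrullDomain_iff.1 h
  refine ⟨fun t s hs => ?_⟩
  by_contra! hcon
  have ht : 0 < t := by simpa using hcon 0
  let s' : AddSubmonoid.nonneg G := ⟨s, hs.le⟩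
  let t' : AddSubmonoid.nonneg G := ⟨t, ht.le⟩
  have hne : ∀ x : AddSubmonoid.nonneg G, (single x 1 : D[AddSubmonoid.nonneg G]) ≠ 0 :=
    fun x => single_ne_zero.2 one_ne_zero
  have hdvd : (single s' 1 : D[AddSubmonoid.nonneg G]) ∣ 1 := by
    refine h1 1 (single s' 1) (hne s') fun P hP => ?_
    by_cases hsP : (single s' 1 : D[AddSubmonoid.nonneg G]) ∈ P.asIdeal
    · exfalso
      obtain ⟨n, c, hc, e, he⟩ := exists_dvd_mul_pow_of_height_eq_one hP (hne t') hsP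
      -- The multiple `n + 1` leaves a factor `X^s` in `c` after `X^(n • s)` is cancelled.
      obtain ⟨r, hr⟩ := exists_eq_add_of_le (a := (n + 1) • s') (b := t') (hcon (n + 1)).le
      refine hc ?_
      have : c = single s' 1 * (single r 1 * e) := by
        apply mul_right_cancel₀ (pow_ne_zero n (hne s'))
        rw [he, hr, single_pow, one_pow, ← mul_assoc, mul_right_comm, single_mul_single,
          single_mul_single, one_mul, one_mul, succ_nsmul]
        congr 2
        abel
      rw [this]
      exact P.asIdeal.mul_mem_right _ hsP
    · exact ⟨_, hsP, dvd_mul_right _ _⟩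
  obtain ⟨e, he⟩ := hdvd
  have h0 := congrArg (fun x => x.coeff 0) he
  simp only [coeff_mul_zero_nonneg, coeff_one_zero, coeff_single] at h0
  rw [Finsupp.single_eq_of_ne (fun h => hs.ne (congrArg Subtype.val h)), zero_mul] at h0
  exact one_ne_zero h0

end NonnegAlgebra

/-! ### Passing between `D[S]` and `D[G]` in the Archimedean case -/

section Comparison

variable {D : Type*} [CommRing D] {G : Type*} [AddCommGroup G] [LinearOrder G]
  [IsOrderedAddMonoid G]

/-- The inclusion of `D[S]` into `D[G]`. -/
noncomputable def inclusion (D G : Type*) [CommRing D] [AddCommGroup G] [LinearOrder G]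
    [IsOrderedAddMonoid G] : D[AddSubmonoid.nonneg G] →+* D[G] :=
  mapDomainRingHom D (AddSubmonoid.nonneg G).subtype

theorem inclusion_injective : Function.Injective (inclusion D G) :=
  mapDomain_injective (AddSubmonoid.subtype_injective _)

theorem isLocalization_inclusion (D G : Type*) [CommRing D] [AddCommGroup G] [LinearOrder G]
    [IsOrderedAddMonoid G] :
    letI := (inclusion D G).toAlgebra
    IsLocalization (monomials D (AddSubmonoid.nonneg G)) D[G] := by
  refine isLocalization_mapDomainRingHom D _ (AddSubmonoid.subtype_injective _) fun b => ?_
  rcases le_total 0 b with h | h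
  · exact ⟨0, ⟨b, h⟩, by simp⟩
  · exact ⟨⟨-b, neg_nonneg.2 h⟩, 0, by simp⟩

theorem isUnit_inclusion_single (s : AddSubmonoid.nonneg G) :
    IsUnit (inclusion D G (single s 1)) := by
  rw [inclusion, mapDomainRingHom_apply, mapDomain_single]
  exact isUnit_single _ isUnit_one

theorem exists_mul_single_eq_inclusion (f : D[G]) :
    ∃ (s : AddSubmonoid.nonneg G) (g : D[AddSubmonoid.nonneg G]),
      f * inclusion D G (single s 1) = inclusion D G g := by
  let := (inclusion D G).toAlgebra
  have := isLocalization_inclusion D G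
  obtain ⟨⟨g, x, hx⟩, h⟩ := IsLocalization.surj (monomials D (AddSubmonoid.nonneg G)) f
  obtain ⟨s, rfl⟩ := (mem_monomials D).1 hx
  exact ⟨s, g, h⟩

theorem exists_dvd_single_mul {a b : D[AddSubmonoid.nonneg G]}
    (h : inclusion D G b ∣ inclusion D G a) : ∃ s, b ∣ single s 1 * a := by
  obtain ⟨c, hc⟩ := h
  obtain ⟨s, g, hs⟩ := exists_mul_single_eq_inclusion c
  refine ⟨s, g, inclusion_injective ?_⟩
  rw [map_mul, map_mul, hc, ← hs]
  ring

theorem comap_inclusion_mem_heightOnePrimes {Q : PrimeSpectrum D[G]}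
    (hQ : Q ∈ heightOnePrimes D[G]) :
    PrimeSpectrum.comap (inclusion D G) Q ∈ heightOnePrimes D[AddSubmonoid.nonneg G] := by
  let := (inclusion D G).toAlgebra
  have := isLocalization_inclusion D G
  exact comap_mem_heightOnePrimes (monomials D (AddSubmonoid.nonneg G)) hQ

theorem comap_inclusion_injective :
    Function.Injective (PrimeSpectrum.comap (inclusion D G)) := by
  let := (inclusion D G).toAlgebra
  have := isLocalization_inclusion D G
  exact PrimeSpectrum.localization_comap_injective D[G] (monomials D (AddSubmonoid.nonneg G))

theorem exists_eq_comap_inclusion {P : PrimeSpectrum D[AddSubmonoid.nonneg G]}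
    (hP : P ∈ heightOnePrimes D[AddSubmonoid.nonneg G])
    (h : ∀ s, s ≠ 0 → (single s 1 : D[AddSubmonoid.nonneg G]) ∉ P.asIdeal) :
    ∃ Q ∈ heightOnePrimes D[G], P = PrimeSpectrum.comap (inclusion D G) Q := by
  let := (inclusion D G).toAlgebra
  have := isLocalization_inclusion D G
  obtain ⟨Q, hQ, he⟩ := exists_comap_eq_of_disjoint (B := D[G])
    (monomials D (AddSubmonoid.nonneg G)) hP (by
      rw [Set.disjoint_left]
      intro x hx
      obtain ⟨s, rfl⟩ := (mem_monomials D).1 hx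
      by_cases hs : s = 0
      · rw [hs, ← one_def]
        exact fun h => P.2.ne_top ((Ideal.eq_top_iff_one _).2 h)
      · exact h s hs)
  exact ⟨Q, hQ, PrimeSpectrum.ext he.symm⟩

variable [IsDomain D]

theorem isWeaklyKrullDomain_group_of_nonneg [Archimedean G]
    (h : IsWeaklyKrullDomain D[AddSubmonoid.nonneg G]) : IsWeaklyKrullDomain D[G] := by
  obtain ⟨h1, h2⟩ := isWeaklyKrullDomain_iff.1 h
  rw [isWeaklyKrullDomain_iff]
  constructor
  · intro a b hb hab
    obtain ⟨s, a', ha'⟩ := exists_mul_single_eq_inclusion a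
    obtain ⟨t, b', hb'⟩ := exists_mul_single_eq_inclusion b
    have hus := isUnit_inclusion_single (D := D) s
    have hut := isUnit_inclusion_single (D := D) t
    have hb0 : b' ≠ 0 := by
      rintro rfl
      rw [map_zero] at hb'
      exact hb (hut.mul_left_eq_zero.1 hb')
    obtain ⟨b'', hb'', he⟩ := exists_eq_single_ord_mul hb0
    -- The factor `X^(ord b')`, a unit in `D[G]`, secures divisibility at `positiveIdeal`, where
    -- `b''` is the witness. All other height-one primes come from `D[G]`.
    have hdvd : b' ∣ single (ord b') 1 * a' := by
      refine h1 _ _ hb0 fun P hP => ?_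
      by_cases hex : ∃ r : AddSubmonoid.nonneg G, r ≠ 0 ∧ single r 1 ∈ P.asIdeal
      · obtain ⟨r, hr, hrP⟩ := hex
        refine ⟨b'', by rwa [eq_positiveIdeal hP hr hrP], a', ?_⟩
        conv_rhs => rw [he]
        ring
      · push Not at hex
        obtain ⟨Q, hQ, rfl⟩ := exists_eq_comap_inclusion hP hex
        obtain ⟨x, hx, hbx⟩ := hab Q hQ
        obtain ⟨r, x', hx'⟩ := exists_mul_single_eq_inclusion x
        have hdvd' : inclusion D G b' ∣ inclusion D G (x' * a') := by
          rw [map_mul, ← hb', ← hx', ← ha', hut.mul_right_dvd]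
          exact hbx.trans ⟨inclusion D G (single r 1) * inclusion D G (single s 1), by ring⟩
        obtain ⟨q, hq⟩ := exists_dvd_single_mul hdvd'
        refine ⟨single q 1 * x', fun hmem => ?_, hq.trans ⟨single (ord b') 1, by ring⟩⟩
        have hmem' : inclusion D G (single q 1 * x') ∈ Q.asIdeal := hmem
        rw [map_mul, Ideal.unit_mul_mem_iff_mem _ (isUnit_inclusion_single q), ← hx',
          Ideal.mul_unit_mem_iff_mem _ (isUnit_inclusion_single r)] at hmem'
        exact hx hmem'
    have := map_dvd (inclusion D G) hdvd
    rw [map_mul, (isUnit_inclusion_single (D := D) (ord b')).dvd_mul_left, ← hb', ← ha',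
      hut.mul_right_dvd, hus.dvd_mul_right] at this
    exact this
  · intro a ha hu
    obtain ⟨s, a', ha'⟩ := exists_mul_single_eq_inclusion a
    have hus := isUnit_inclusion_single (D := D) s
    have hfin := h2 a' (by
      rintro rfl
      rw [map_zero] at ha'
      exact ha (hus.mul_left_eq_zero.1 ha')) fun hu' =>
        hu (isUnit_of_mul_isUnit_left (ha' ▸ hu'.map (inclusion D G)))
    refine Set.Finite.of_injOn (f := PrimeSpectrum.comap (inclusion D G)) ?_
      comap_inclusion_injective.injOn hfin
    intro Q hQ
    refine ⟨comap_inclusion_mem_heightOnePrimes hQ.1, ?_⟩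
    change inclusion D G a' ∈ Q.asIdeal
    rw [← ha']
    exact Q.asIdeal.mul_mem_right _ hQ.2

theorem isWeaklyKrullDomain_nonneg_of_group [Archimedean G] (h : IsWeaklyKrullDomain D[G]) :
    IsWeaklyKrullDomain D[AddSubmonoid.nonneg G] := by
  obtain ⟨h1, h2⟩ := isWeaklyKrullDomain_iff.1 h
  rw [isWeaklyKrullDomain_iff]
  constructor
  · intro a b hb hab
    by_cases ha : a = 0
    · rw [ha]; exact dvd_zero b
    have hdvd : inclusion D G b ∣ inclusion D G a := by
      refine h1 _ _ (fun h0 => hb (inclusion_injective (h0.trans (map_zero _).symm))) fun Q hQ => ?_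
      obtain ⟨s, hs, hd⟩ := hab _ (comap_inclusion_mem_heightOnePrimes hQ)
      exact ⟨inclusion D G s, hs, by rw [← map_mul]; exact map_dvd _ hd⟩
    obtain ⟨n, c, hc⟩ := exists_dvd_single_mul hdvd
    have hne : (single n 1 : D[AddSubmonoid.nonneg G]) ≠ 0 := single_ne_zero.2 one_ne_zero
    have hc0 : c ≠ 0 := by
      rintro rfl
      rw [mul_zero] at hc
      exact mul_ne_zero hne ha hc
    -- Divisibility at `positiveIdeal` compares orders, since elements outside it have order `0`.
    -- With `X^n * a = b * c` this gives `n ≤ ord c`, so `X^n` cancels.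
    have hord : (ord b : G) ≤ ord a := by
      cases subsingleton_or_nontrivial (AddSubmonoid.nonneg G) with
      | inl _ => rw [Subsingleton.elim (ord a) (ord b)]
      | inr _ =>
        obtain ⟨s, hs, e, he⟩ := hab ⟨_, positiveIdeal_isPrime⟩ height_positiveIdeal
        have hs0 : s ≠ 0 := by rintro rfl; exact hs (Ideal.zero_mem _)
        have he0 : e ≠ 0 := by
          rintro rfl
          rw [mul_zero] at he
          exact mul_ne_zero hs0 ha he
        have h3 := congrArg (fun x => (ord x : G)) he
        simp only [ord_mul hs0 ha, ord_mul hb he0, ord_eq_zero hs, AddSubmonoid.coe_add,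
          zero_add] at h3
        rw [h3]
        exact le_add_of_nonneg_right (ord e).2
    have hord' : ∀ t, c.coeff t ≠ 0 → (n : G) ≤ t := by
      intro t ht
      refine le_trans ?_ (ord_le ht)
      have h3 := congrArg (fun x => (ord x : G)) hc
      simp only [ord_mul hne ha, ord_mul hb hc0, AddSubmonoid.coe_add] at h3
      rw [show ord (single n (1 : D)) = n from
        top_single neg_subtype_injective _ one_ne_zero] at h3
      by_contra hlt
      exact absurd h3 (by
        rw [add_comm (ord b : G)]
        exact (add_lt_add_of_lt_of_le (not_le.1 hlt) hord).ne')
    obtain ⟨d, rfl⟩ := single_dvd_of_forall_le hord'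
    refine ⟨d, mul_left_cancel₀ hne ?_⟩
    rw [hc]
    ring
  · intro a ha hu
    have hfin : {Q ∈ heightOnePrimes D[G] | inclusion D G a ∈ Q.asIdeal}.Finite := by
      by_cases hgu : IsUnit (inclusion D G a)
      · refine Set.finite_empty.subset fun P hP => ?_
        exact P.2.ne_top (Ideal.eq_top_of_isUnit_mem _ hP.2 hgu)
      · exact h2 _ (fun h0 => ha (inclusion_injective (h0.trans (map_zero _).symm))) hgu
    refine ((Set.finite_singleton (⟨_, positiveIdeal_isPrime⟩ :
      PrimeSpectrum D[AddSubmonoid.nonneg G])).union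
        (hfin.image (PrimeSpectrum.comap (inclusion D G)))).subset ?_
    rintro P ⟨hP, haP⟩
    by_cases hex : ∃ r : AddSubmonoid.nonneg G, r ≠ 0 ∧ single r 1 ∈ P.asIdeal
    · obtain ⟨r, hr, hrP⟩ := hex
      exact Or.inl (PrimeSpectrum.ext (eq_positiveIdeal hP hr hrP))
    · push Not at hex
      obtain ⟨Q, hQ, rfl⟩ := exists_eq_comap_inclusion hP hex
      exact Or.inr ⟨Q, ⟨hQ, haP⟩, rfl⟩

end Comparison

end WeaklyKrull

theorem mainTheorem11 {D : Type*} [CommRing D] [IsDomain D]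
    {G : Type*} [AddCommGroup G] [LinearOrder G] [IsOrderedAddMonoid G]
    (hG : WeaklyKrull.ACCCyclicSubgroups G) :
    WeaklyKrull.IsWeaklyKrullDomain (AddMonoidAlgebra D (AddSubmonoid.nonneg G)) ↔
      (WeaklyKrull.IsWeaklyKrullDomain D ∧ WeaklyKrull.IsUMT D G) ∧
        WeaklyKrull.IsWeaklyKrullMonoid (AddSubmonoid.nonneg G) := by
  rw [← WeaklyKrull.isWeaklyKrullDomain_groupAlgebra_iff hG,
    WeaklyKrull.isWeaklyKrullMonoid_nonneg_iff]
  constructor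
  · intro h
    have := WeaklyKrull.archimedean_of_isWeaklyKrullDomain h
    exact ⟨WeaklyKrull.isWeaklyKrullDomain_group_of_nonneg h, this⟩
  · rintro ⟨h, _⟩
    exact WeaklyKrull.isWeaklyKrullDomain_nonneg_of_group h
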